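/- Let $d,d',T\ge 1$ be integers, let $A\in\mathbb R^{d\times d}$ be nonsingular and $B\in\mathbb R^{d\times d'}$, let $\gamma>0$, and let $\alpha=c_\alpha\,\mathcal N(m_\alpha,\Sigma_\alpha)$ and $\beta=c_\beta\,\mathcal N(m_\beta,\Sigma_\beta)$ with $c_\alpha,c_\beta>0$, $m_\alpha,m_\beta\in\mathbb R^d$ and $\Sigma_\alpha,\Sigma_\beta\in\mathbb R^{d\times d}$ symmetric positive definite. For a measure $\pi_1$ on $\mathbb R^d$ and Markov kernels $U_t(\mathrm du\mid x)$ from $\mathbb R^d$ to $\mathbb R^{d'}$, $t=1,\dots,T-1$, let $\pi_{t+1}$ be the image of the measure $U_t(\mathrm du\mid x)\,\pi_t(\mathrm dx)$ under $(x,u)\mapsto Ax+Bu$. Call $(\pi_1,U_1,\dots,U_{T-1})$ admissible if $\pi_1,\dots,\pi_T$ are finite nonnegative measures with finite second moment and $\sum_{t=1}^{T-1}\int\!\int\|u\|^2\,U_t(\mathrm du\mid x)\,\pi_t(\mathrm dx)<\infty$. The unbalanced density control (UDC) problem is to minimize, over all admissible $(\pi_1,U_1,\dots,U_{T-1})$,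 $$J(\pi_1,U_1,\dots,U_{T-1})=\sum_{t=1}^{T-1}\int_{\mathbb R^d}\int_{\mathbb R^{d'}}\|u\|^2\,U_t(\mathrm du\mid x)\,\pi_t(\mathrm dx)+\gamma\,\mathrm{KL}(\pi_1\,\|\,\alpha)+\gamma\,\mathrm{KL}(\pi_T\,\|\,\beta),$$ where $\mathrm{KL}(\mu\,\|\,\nu)=\int\log\frac{\mathrm d\mu}{\mathrm d\nu}\,\mathrm d\mu+\nu(\mathbb R^d)-\mu(\mathbb R^d)$ if $\mu\ll\nu$, and $\mathrm{KL}(\mu\,\|\,\nu)=+\infty$ otherwise. Then the UDC problem has an optimal solution $(\pi_1,U_1,\dots,U_{T-1})$ consisting of a Gaussian initial measure $\pi_1=c\,\mathcal N(m,\Sigma)$ with $c>0$, $m\in\mathbb R^d$ and $\Sigma$ positive definite, and of affine-Gaussian control laws $U_t(\cdot\mid x)=\mathcal N(K_tx+v_t,\,Q_t)$, $t=1,\dots,T-1$, with $K_t\in\mathbb R^{d'\times d}$, $v_t\in\mathbb R^{d'}$ and $Q_t\in\mathbb R^{d'\times d'}$ positive semidefinite. -/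

import Mathlib

open MeasureTheory ProbabilityTheory Matrix
open scoped ENNReal

noncomputable section

namespace UDC

/-- The unbalanced Gaussian measure `c · N(m, S)` on `ℝⁿ` (meaningful for `0 ≤ c` and `S`
positive semidefinite). -/
def gaussianMeasure {n : ℕ} (c : ℝ) (m : EuclideanSpace ℝ (Fin n))
    (S : Matrix (Fin n) (Fin n) ℝ) : Measure (EuclideanSpace ℝ (Fin n)) :=
  ENNReal.ofReal c • multivariateGaussian m S

/-- Finite nonnegative measures with finite second moment. -/
def FiniteSecondMoment {n : ℕ} (μ : Measure (EuclideanSpace ℝ (Fin n))) : Prop :=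
  IsFiniteMeasure μ ∧ ∫⁻ x, ‖x‖ₑ ^ 2 ∂μ < ∞

/-- The state measures generated by `x_{t+1} = A x_t + B u_t` from the initial measure `π₁` under
the randomized feedback laws `U`. Times are counted from `0`: `stateMeasure A B π₁ U t` is the
state measure after `t` steps (the measure usually called `π_{t+1}` when the initial measure is
`π_1`), and `U t` is the conditional law of the control given the state after `t` steps. -/
def stateMeasure {d d' : ℕ} (A : Matrix (Fin d) (Fin d) ℝ) (B : Matrix (Fin d) (Fin d') ℝ)
    (π₁ : Measure (EuclideanSpace ℝ (Fin d)))
    (U : ℕ → Kernel (EuclideanSpace ℝ (Fin d)) (EuclideanSpace ℝ (Fin d'))) :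
    ℕ → Measure (EuclideanSpace ℝ (Fin d))
  | 0 => π₁
  | t + 1 => (stateMeasure A B π₁ U t ⊗ₘ U t).map
      (fun p => Matrix.toEuclideanLin A p.1 + Matrix.toEuclideanLin B p.2)

/-- The control effort `∑ₜ ∫∫ ‖u‖² U_t(du|x) π_t(dx)` over the `T - 1` steps of a horizon with
`T` state measures. -/
def controlEffort {d d' : ℕ} (A : Matrix (Fin d) (Fin d) ℝ) (B : Matrix (Fin d) (Fin d') ℝ)
    (T : ℕ) (π₁ : Measure (EuclideanSpace ℝ (Fin d)))
    (U : ℕ → Kernel (EuclideanSpace ℝ (Fin d)) (EuclideanSpace ℝ (Fin d'))) : ℝ≥0∞ :=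
  ∑ t ∈ Finset.range (T - 1), ∫⁻ x, ∫⁻ u, ‖u‖ₑ ^ 2 ∂(U t x) ∂(stateMeasure A B π₁ U t)

/-- The admissible set: every `U t` used within the horizon is a Markov kernel, all `T` state
measures are finite with finite second moment, and the control effort is finite. Only the entries
`U t` with `t < T - 1` matter. -/
def Admissible {d d' : ℕ} (A : Matrix (Fin d) (Fin d) ℝ) (B : Matrix (Fin d) (Fin d') ℝ)
    (T : ℕ) (π₁ : Measure (EuclideanSpace ℝ (Fin d)))
    (U : ℕ → Kernel (EuclideanSpace ℝ (Fin d)) (EuclideanSpace ℝ (Fin d'))) : Prop :=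
  (∀ t < T - 1, IsMarkovKernel (U t)) ∧
  (∀ t < T, FiniteSecondMoment (stateMeasure A B π₁ U t)) ∧
  controlEffort A B T π₁ U < ∞

/-- The objective: control effort plus `γ` times the Kullback-Leibler divergences of the initial
and terminal state measures from the references `α` and `β`. -/
def cost {d d' : ℕ} (A : Matrix (Fin d) (Fin d) ℝ) (B : Matrix (Fin d) (Fin d') ℝ)
    (T : ℕ) (γ : ℝ) (α β π₁ : Measure (EuclideanSpace ℝ (Fin d)))
    (U : ℕ → Kernel (EuclideanSpace ℝ (Fin d)) (EuclideanSpace ℝ (Fin d'))) : ℝ≥0∞ :=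
  controlEffort A B T π₁ U + ENNReal.ofReal γ * InformationTheory.klDiv π₁ α
    + ENNReal.ofReal γ * InformationTheory.klDiv (stateMeasure A B π₁ U (T - 1)) β

/-- `(π₁, U)` is an optimal solution: it is admissible and no admissible pair costs less. -/
def IsOptimal {d d' : ℕ} (A : Matrix (Fin d) (Fin d) ℝ) (B : Matrix (Fin d) (Fin d') ℝ)
    (T : ℕ) (γ : ℝ) (α β π₁ : Measure (EuclideanSpace ℝ (Fin d)))
    (U : ℕ → Kernel (EuclideanSpace ℝ (Fin d)) (EuclideanSpace ℝ (Fin d'))) : Prop :=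
  Admissible A B T π₁ U ∧
  ∀ (π₁' : Measure (EuclideanSpace ℝ (Fin d)))
    (U' : ℕ → Kernel (EuclideanSpace ℝ (Fin d)) (EuclideanSpace ℝ (Fin d'))),
    Admissible A B T π₁' U' → cost A B T γ α β π₁ U ≤ cost A B T γ α β π₁' U'

/-- An affine-Gaussian control law: `U(·|x) = N(K x + v, Q)` with `Q` positive semidefinite
(possibly singular, so that deterministic affine feedback is included). -/
def IsAffineGaussian {d d' : ℕ}
    (U : Kernel (EuclideanSpace ℝ (Fin d)) (EuclideanSpace ℝ (Fin d'))) : Prop :=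
  ∃ (K : Matrix (Fin d') (Fin d) ℝ) (v : EuclideanSpace ℝ (Fin d'))
    (Q : Matrix (Fin d') (Fin d') ℝ), Q.PosSemidef ∧
    ∀ x, U x = multivariateGaussian (Matrix.toEuclideanLin K x + v) Q

end UDC

end

/-! ### Lebesgue densities of Gaussian measures -/

namespace UDC

open scoped RealInnerProductSpace MatrixOrder

/-! The problem collapses to finitely many real parameters because every term of the cost is
governed by mass, means and covariances. The control effort is exactly a function of the moments of
the controls. As for the divergences, let `p` be a probability measure with mean `m` and nonsingular
covariance `S`: the log-density of N(m, S) relative to a Gaussian reference is a quadratic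
polynomial, so its integral against `p` depends only on `m` and `S`, and KL(p ‖ ref) = KL(p ‖ N(m,
S)) + KL(N(m, S) ‖ ref). Hence the Gaussian is the cheapest measure with given moments
(`HasMoments.gaussianKL_le_integral_llr`). Conversely, whenever the joint covariance of state and
control at each step is positive semidefinite, regressing the control on the state gives
affine-Gaussian laws that realize these moments (`exists_affineGaussian_step`). A plan of finite
cost can therefore be replaced by a Gaussian one without increasing the cost.

What remains is a finite-dimensional minimization over a mass `c` and normalized moment data related
by `Reach`. State measures and effort are homogeneous in the initial measure, so the cost is
`scaledCost` at `c` and `j`, with `j` the cost of the normalized data. It is nondecreasing in `j`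
for every `c ≥ 0`, so `j` may be minimized first, independently of `c`. That minimum exists by
compactness (`exists_momentCost_min`): sublevel sets of the Gaussian divergence are bounded and keep
away from singular covariances, and reachable data with bounded initial moments and effort form a
compact set. The remaining function of `c` has the explicit positive minimizer `optimalMass`, which
also beats the zero measure `c = 0`. -/

lemma stdGaussian_eq_withDensity (n : ℕ) :
    stdGaussian (EuclideanSpace ℝ (Fin n)) = volume.withDensity fun x =>
      ENNReal.ofReal (Real.exp (-(1 / 2) * ‖x‖ ^ 2 - n / 2 * Real.log (2 * Real.pi))) := by
  have hpi : (0 : ℝ) < 2 * Real.pi := by positivity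
  have hconst : Real.exp (-(n / 2 * Real.log (2 * Real.pi))) = ((2 * Real.pi) ^ ((n : ℝ) / 2))⁻¹ := by
    rw [Real.rpow_def_of_pos hpi, ← Real.exp_neg, mul_comm (Real.log _)]
  have hexp (x : EuclideanSpace ℝ (Fin n)) :
      Real.exp (-(1 / 2) * ‖x‖ ^ 2 - n / 2 * Real.log (2 * Real.pi)) =
        ((2 * Real.pi) ^ ((n : ℝ) / 2))⁻¹ * Real.exp (-(1 / 2) * ‖x‖ ^ 2) := by
    rw [← hconst, ← Real.exp_add]; ring_nf
  have hint : Integrable (fun x : EuclideanSpace ℝ (Fin n) =>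
      Real.exp (-(1 / 2) * ‖x‖ ^ 2 - n / 2 * Real.log (2 * Real.pi))) := by
    simp_rw [hexp]
    refine Integrable.const_mul ?_ _
    have h := (GaussianFourier.integrable_cexp_neg_mul_sq_norm_add (b := 1 / 2)
      (V := EuclideanSpace ℝ (Fin n)) (by norm_num) 0 0).norm
    refine h.congr (ae_of_all _ fun x => ?_)
    simp only [Complex.norm_exp, zero_mul, add_zero]
    norm_cast
    simp [-Complex.ofReal_pow]
  have := isFiniteMeasure_withDensity_ofReal hint.2
  -- Both measures are finite, so it suffices to compare characteristic functions; the one on the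
  -- density side is a Gaussian Fourier integral whose prefactor cancels the normalizing constant.
  refine Measure.ext_of_charFun (funext fun t => ?_)
  rw [charFun_stdGaussian, charFun_apply, integral_withDensity_eq_integral_toReal_smul
    (by fun_prop) (ae_of_all _ fun x => ENNReal.ofReal_lt_top)]
  have key := GaussianFourier.integral_cexp_neg_mul_sq_norm_add (b := 1 / 2)
      (V := EuclideanSpace ℝ (Fin n)) (by norm_num) Complex.I t
  have : ∀ x : EuclideanSpace ℝ (Fin n), (ENNReal.ofReal (Real.exp (-(1 / 2) * ‖x‖ ^ 2 -
      n / 2 * Real.log (2 * Real.pi)))).toReal • Complex.exp (⟪x, t⟫ * Complex.I) =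
      (((2 * Real.pi) ^ ((n : ℝ) / 2))⁻¹ : ℝ) *
        Complex.exp (-(1 / 2) * ‖x‖ ^ 2 + Complex.I * ⟪t, x⟫) := by
    intro x
    rw [ENNReal.toReal_ofReal (Real.exp_pos _).le, hexp, Complex.real_smul, Complex.ofReal_mul,
      Complex.exp_add, Complex.ofReal_exp, real_inner_comm, mul_comm Complex.I]
    push_cast
    ring
  simp_rw [this]
  rw [integral_const_mul, key, ← mul_assoc]
  have h1 : ((((2 * Real.pi) ^ ((n : ℝ) / 2))⁻¹ : ℝ) : ℂ) *
      (Real.pi / (1 / 2) : ℂ) ^ ((Module.finrank ℝ (EuclideanSpace ℝ (Fin n)) : ℂ) / 2) = 1 := by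
    have : (Real.pi / (1 / 2) : ℂ) ^ ((Module.finrank ℝ (EuclideanSpace ℝ (Fin n)) : ℂ) / 2) =
        (((2 * Real.pi) ^ ((n : ℝ) / 2) : ℝ) : ℂ) := by
      rw [Complex.ofReal_cpow hpi.le, finrank_euclideanSpace_fin]
      push_cast
      congr 1
      ring
    rw [this, ← Complex.ofReal_mul, inv_mul_cancel₀ (by positivity), Complex.ofReal_one]
  rw [h1, one_mul, Complex.I_sq]
  congr 1
  ring

/-- The logarithm of the Lebesgue density of `N(m, S)`. -/
noncomputable def logGaussianPDF {n : ℕ} (m : EuclideanSpace ℝ (Fin n))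
    (S : Matrix (Fin n) (Fin n) ℝ) (x : EuclideanSpace ℝ (Fin n)) : ℝ :=
  -(1 / 2) * ((x - m).ofLp ⬝ᵥ S⁻¹ *ᵥ (x - m).ofLp) - 1 / 2 * Real.log S.det
    - n / 2 * Real.log (2 * Real.pi)

@[fun_prop]
lemma measurable_logGaussianPDF {n : ℕ} (m : EuclideanSpace ℝ (Fin n))
    (S : Matrix (Fin n) (Fin n) ℝ) : Measurable (logGaussianPDF m S) := by
  unfold logGaussianPDF
  simp only [dotProduct, mulVec]
  fun_prop

/-- Change of variables `x = m + R y` with `R` the square root of `S`: the Jacobian |det R| accounts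
for the term `1 / 2 * log (det S)`, and the quadratic form in `S⁻¹` becomes ‖y‖². -/
lemma multivariateGaussian_eq_withDensity {n : ℕ} (m : EuclideanSpace ℝ (Fin n))
    {S : Matrix (Fin n) (Fin n) ℝ} (hS : S.PosDef) :
    multivariateGaussian m S =
      volume.withDensity fun x => ENNReal.ofReal (Real.exp (logGaussianPDF m S x)) := by
  set R := CFC.sqrt S with hR
  have hRR : R * R = S := CFC.sqrt_mul_sqrt_self S hS.posSemidef.nonneg
  have hRt : Rᵀ = R := by
    have h := (CFC.sqrt_nonneg S).isSelfAdjoint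
    rwa [IsSelfAdjoint, star_eq_conjTranspose, conjTranspose_eq_transpose_of_trivial] at h
  have hdet : R.det * R.det = S.det := by rw [← det_mul, hRR]
  have hRdet : R.det ≠ 0 := fun h => hS.det_pos.ne' (by rw [← hdet, h, zero_mul])
  have hlog : Real.log |R.det| = 1 / 2 * Real.log S.det := by
    rw [← hdet, ← sq, Real.log_pow, Real.log_abs]; ring
  have hRinv : IsUnit R.det := isUnit_iff_ne_zero.2 hRdet
  have hLdet : LinearMap.det (toEuclideanLin R) = R.det := by
    rw [toEuclideanLin_eq_toLin_orthonormal, LinearMap.det_toLin]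
  have hpdf (y : EuclideanSpace ℝ (Fin n)) :
      logGaussianPDF m S (m + toEuclideanLin R y) =
        -(1 / 2) * ‖y‖ ^ 2 - n / 2 * Real.log (2 * Real.pi) - Real.log |R.det| := by
    have h1 : (toEuclideanLin R y).ofLp ⬝ᵥ S⁻¹ *ᵥ (toEuclideanLin R y).ofLp = ‖y‖ ^ 2 := by
      have e : (toEuclideanLin R y).ofLp = R *ᵥ y.ofLp := rfl
      rw [e, mulVec_mulVec, ← hRR, Matrix.mul_inv_rev, mul_assoc, nonsing_inv_mul _ hRinv, mul_one,
        dotProduct_mulVec, vecMul_mulVec, hRt, mul_nonsing_inv _ hRinv,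
        EuclideanSpace.real_norm_sq_eq, vecMul_one]
      simp [dotProduct, sq]
    unfold logGaussianPDF
    rw [add_sub_cancel_left, h1, hlog]
    ring
  refine Measure.ext_of_lintegral _ fun g hg => ?_
  have hmul : Measurable (fun x => ENNReal.ofReal (Real.exp (logGaussianPDF m S x)) * g x) := by
    fun_prop
  have hL : Measurable (toEuclideanLin R) :=
    (LinearMap.continuous_of_finiteDimensional _).measurable
  have hvol := Measure.map_linearMap_addHaar_eq_smul_addHaar
    (volume : Measure (EuclideanSpace ℝ (Fin n))) (f := toEuclideanLin R) (by rwa [hLdet])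
  have hvol' : (volume : Measure (EuclideanSpace ℝ (Fin n))) =
      ENNReal.ofReal |R.det| • Measure.map (toEuclideanLin R) volume := by
    rw [hvol, hLdet, smul_smul, ← ENNReal.ofReal_mul (abs_nonneg _), ← abs_mul,
      mul_inv_cancel₀ hRdet, abs_one, ENNReal.ofReal_one, one_smul]
  rw [lintegral_withDensity_eq_lintegral_mul _ (by fun_prop) hg]
  simp only [Pi.mul_apply]
  rw [← lintegral_add_left_eq_self (μ := volume) _ m, hvol', lintegral_smul_measure, lintegral_map (by fun_prop) hL,
    multivariateGaussian, lintegral_map hg (by fun_prop), stdGaussian_eq_withDensity,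
    lintegral_withDensity_eq_lintegral_mul _ (by fun_prop) (by fun_prop), smul_eq_mul,
    ← lintegral_const_mul _ (by fun_prop)]
  refine lintegral_congr fun y => ?_
  rw [hpdf, Pi.mul_apply, ← mul_assoc, ← ENNReal.ofReal_mul (abs_nonneg _), Real.exp_sub _ (Real.log _),
    Real.exp_log (abs_pos.2 hRdet), mul_div_cancel₀ _ (abs_ne_zero.2 hRdet)]
  rfl

end UDC

/-! ### Means and covariances -/

namespace UDC

/-- `p` is a probability measure with finite second moment, mean `m` and covariance matrix `S`. -/
structure HasMoments {n : ℕ} (p : Measure (EuclideanSpace ℝ (Fin n)))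
    (m : EuclideanSpace ℝ (Fin n)) (S : Matrix (Fin n) (Fin n) ℝ) : Prop where
  prob : IsProbabilityMeasure p
  memLp : MemLp id 2 p
  mean : ∀ i, ∫ x, x i ∂p = m i
  cov : ∀ i j, cov[fun x => x i, fun x => x j; p] = S i j

lemma memLp_coord {Ω : Type*} [MeasurableSpace Ω] {P : Measure Ω} {n : ℕ}
    {X : Ω → EuclideanSpace ℝ (Fin n)} (hX : MemLp X 2 P) (i : Fin n) :
    MemLp (fun ω => X ω i) 2 P :=
  (EuclideanSpace.proj i : EuclideanSpace ℝ (Fin n) →L[ℝ] ℝ).comp_memLp' hX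

/-- The quadratic form at `x` is the variance of `∑ i, x i * Z i`. -/
lemma posSemidef_cov {Ω ι : Type*} [MeasurableSpace Ω] [Fintype ι] {P : Measure Ω}
    [IsProbabilityMeasure P] {Z : ι → Ω → ℝ} (hZ : ∀ i, MemLp (Z i) 2 P) :
    (Matrix.of fun i j => cov[Z i, Z j; P]).PosSemidef := by
  refine PosSemidef.of_dotProduct_mulVec_nonneg ?_ fun x => ?_
  · ext i j
    simp [covariance_comm]
  · have : star x ⬝ᵥ (Matrix.of fun i j => cov[Z i, Z j; P]) *ᵥ x =
        cov[fun ω => ∑ i, x i * Z i ω, fun ω => ∑ i, x i * Z i ω; P] := by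
      rw [covariance_fun_sum_fun_sum (fun i => (hZ i).const_mul (x i))
        (fun i => (hZ i).const_mul (x i))]
      simp only [dotProduct, mulVec, star_trivial, of_apply, Finset.mul_sum,
        covariance_const_mul_left, covariance_const_mul_right]
      exact Finset.sum_congr rfl fun i _ => Finset.sum_congr rfl fun j _ => by ring
    rw [this, covariance_self]
    · exact variance_nonneg _ _
    · exact (memLp_finsetSum _ fun i _ => (hZ i).const_mul (x i)).aemeasurable

namespace HasMoments

variable {n : ℕ} {p : Measure (EuclideanSpace ℝ (Fin n))} {m : EuclideanSpace ℝ (Fin n)}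
  {S : Matrix (Fin n) (Fin n) ℝ}

lemma posSemidef (h : HasMoments p m S) : S.PosSemidef := by
  have := h.prob
  have e : S = Matrix.of fun i j => cov[fun x => x i, fun x => x j; p] := by
    ext i j; exact (h.cov i j).symm
  rw [e]
  exact posSemidef_cov fun i => memLp_coord h.memLp i

lemma integrable_mul (h : HasMoments p m S) (a : EuclideanSpace ℝ (Fin n)) (i j : Fin n) :
    Integrable (fun x => (x i - a i) * (x j - a j)) p := by
  have := h.prob
  exact ((memLp_coord h.memLp i).sub (memLp_const (a i))).integrable_mul
    ((memLp_coord h.memLp j).sub (memLp_const (a j)))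

lemma integral_mul (h : HasMoments p m S) (a : EuclideanSpace ℝ (Fin n)) (i j : Fin n) :
    ∫ x, (x i - a i) * (x j - a j) ∂p = S i j + (m i - a i) * (m j - a j) := by
  have := h.prob
  have hi (i : Fin n) : MemLp (fun x : EuclideanSpace ℝ (Fin n) => x i) 2 p := memLp_coord h.memLp i
  have hi1 (i : Fin n) := (hi i).integrable one_le_two
  have hs (i : Fin n) : MemLp (fun x : EuclideanSpace ℝ (Fin n) => x i - a i) 2 p :=
    (hi i).sub (memLp_const (a i))
  have h1 := covariance_eq_sub (hs i) (hs j)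
  rw [covariance_sub_const_left (hi1 i), covariance_sub_const_right (hi1 j), h.cov] at h1
  have hm (i : Fin n) : ∫ x, (x i - a i) ∂p = m i - a i := by
    rw [integral_sub (hi1 i) (integrable_const _), h.mean]; simp
  rw [hm, hm] at h1
  simp only [Pi.mul_apply] at h1
  linarith

lemma quadratic_eq_sum (P : Matrix (Fin n) (Fin n) ℝ) (y : Fin n → ℝ) :
    y ⬝ᵥ P *ᵥ y = ∑ i, ∑ j, P i j * (y i * y j) := by
  simp only [dotProduct, mulVec, Finset.mul_sum]
  exact Finset.sum_congr rfl fun i _ => Finset.sum_congr rfl fun j _ => by ring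

lemma integrable_quadratic (h : HasMoments p m S) (P : Matrix (Fin n) (Fin n) ℝ)
    (a : EuclideanSpace ℝ (Fin n)) :
    Integrable (fun x => (x - a).ofLp ⬝ᵥ P *ᵥ (x - a).ofLp) p := by
  simp_rw [quadratic_eq_sum]
  exact integrable_finsetSum _ fun i _ => integrable_finsetSum _ fun j _ =>
    (h.integrable_mul a i j).const_mul _

lemma integral_quadratic (h : HasMoments p m S) (P : Matrix (Fin n) (Fin n) ℝ)
    (a : EuclideanSpace ℝ (Fin n)) :
    ∫ x, (x - a).ofLp ⬝ᵥ P *ᵥ (x - a).ofLp ∂p =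
      (P * S).trace + (m - a).ofLp ⬝ᵥ P *ᵥ (m - a).ofLp := by
  have hsymm : ∀ i j, S i j = S j i := fun i j => by rw [← h.cov, ← h.cov, covariance_comm]
  simp_rw [quadratic_eq_sum, PiLp.sub_apply]
  have hint (i j : Fin n) := (h.integrable_mul a i j).const_mul (P i j)
  rw [integral_finsetSum _ fun i _ => integrable_finsetSum _ fun j _ => hint i j]
  simp_rw [integral_finsetSum _ fun j _ => hint _ j]
  simp only [trace, diag, mul_apply, ← Finset.sum_add_distrib]
  refine Finset.sum_congr rfl fun i _ => Finset.sum_congr rfl fun j _ => ?_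
  rw [integral_const_mul, ← hsymm i j]
  rw [h.integral_mul a i j]
  ring

lemma lintegral_enorm_sq (h : HasMoments p m S) :
    ∫⁻ x, ‖x‖ₑ ^ 2 ∂p = ENNReal.ofReal (‖m‖ ^ 2 + S.trace) := by
  have e (x : EuclideanSpace ℝ (Fin n)) : ‖x‖ ^ 2 =
      (x - 0).ofLp ⬝ᵥ (1 : Matrix (Fin n) (Fin n) ℝ) *ᵥ (x - 0).ofLp := by
    rw [EuclideanSpace.real_norm_sq_eq]
    simp [dotProduct, sq]
  have h1 := h.integral_quadratic 1 0
  have h2 := h.integrable_quadratic 1 0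
  simp_rw [← e, one_mul] at h1 h2
  rw [add_comm, ← h1, ofReal_integral_eq_lintegral_ofReal h2 (ae_of_all _ fun x => by positivity)]
  exact lintegral_congr fun x => by
    rw [ENNReal.ofReal_pow (norm_nonneg _), ofReal_norm]

end HasMoments

/-- The law of a square integrable random vector has moments. -/
lemma hasMoments_map {Ω : Type*} [MeasurableSpace Ω] {P : Measure Ω} [IsProbabilityMeasure P]
    {n : ℕ} {X : Ω → EuclideanSpace ℝ (Fin n)} (hX : Measurable X) (hX2 : MemLp X 2 P)
    {m : EuclideanSpace ℝ (Fin n)} {S : Matrix (Fin n) (Fin n) ℝ}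
    (hm : ∀ i, ∫ ω, X ω i ∂P = m i)
    (hS : ∀ i j, cov[fun ω => X ω i, fun ω => X ω j; P] = S i j) :
    HasMoments (P.map X) m S where
  prob := Measure.isProbabilityMeasure_map hX.aemeasurable
  memLp := (memLp_map_measure_iff (by fun_prop) hX.aemeasurable).2 hX2
  mean i := by rw [integral_map hX.aemeasurable (by fun_prop), hm]
  cov i j := by rw [covariance_map (by fun_prop) (by fun_prop) hX.aemeasurable, ← hS]; rfl

lemma HasMoments.cov_of_map {Ω : Type*} [MeasurableSpace Ω] {P : Measure Ω}
    {n : ℕ} {X : Ω → EuclideanSpace ℝ (Fin n)} (hX : Measurable X)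
    {m : EuclideanSpace ℝ (Fin n)} {S : Matrix (Fin n) (Fin n) ℝ}
    (h : HasMoments (P.map X) m S) (i j : Fin n) :
    cov[fun ω => X ω i, fun ω => X ω j; P] = S i j := by
  rw [← h.cov, covariance_map (by fun_prop) (by fun_prop) hX.aemeasurable]; rfl

lemma HasMoments.mean_of_map {Ω : Type*} [MeasurableSpace Ω] {P : Measure Ω}
    {n : ℕ} {X : Ω → EuclideanSpace ℝ (Fin n)} (hX : Measurable X)
    {m : EuclideanSpace ℝ (Fin n)} {S : Matrix (Fin n) (Fin n) ℝ}
    (h : HasMoments (P.map X) m S) (i : Fin n) : ∫ ω, X ω i ∂P = m i := by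
  rw [← h.mean, integral_map hX.aemeasurable (by fun_prop)]

lemma mul_mul_transpose_apply {k l n n' : ℕ} (A : Matrix (Fin n) (Fin k) ℝ)
    (M : Matrix (Fin k) (Fin l) ℝ) (B : Matrix (Fin n') (Fin l) ℝ) (i : Fin n) (j : Fin n') :
    (A * M * Bᵀ) i j = ∑ a, ∑ b, B j b * (A i a * M a b) := by
  simp only [mul_apply, transpose_apply, Finset.sum_mul]
  rw [Finset.sum_comm]
  exact Finset.sum_congr rfl fun _ _ => Finset.sum_congr rfl fun _ _ => by ring

/-- Moments of `A X + B Y` from the joint moments of `(X, Y)`. -/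
lemma hasMoments_map_add {Ω : Type*} [MeasurableSpace Ω] {P : Measure Ω} [IsProbabilityMeasure P]
    {d d' n : ℕ} {X : Ω → EuclideanSpace ℝ (Fin d)} {Y : Ω → EuclideanSpace ℝ (Fin d')}
    (hX : Measurable X) (hY : Measurable Y) (hX2 : MemLp X 2 P) (hY2 : MemLp Y 2 P)
    (A : Matrix (Fin n) (Fin d) ℝ) (B : Matrix (Fin n) (Fin d') ℝ)
    {m : EuclideanSpace ℝ (Fin d)} {S : Matrix (Fin d) (Fin d) ℝ}
    {v : EuclideanSpace ℝ (Fin d')} {C : Matrix (Fin d) (Fin d') ℝ}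
    {V : Matrix (Fin d') (Fin d') ℝ}
    (hm : ∀ i, ∫ ω, X ω i ∂P = m i) (hv : ∀ i, ∫ ω, Y ω i ∂P = v i)
    (hS : ∀ i j, cov[fun ω => X ω i, fun ω => X ω j; P] = S i j)
    (hC : ∀ i j, cov[fun ω => X ω i, fun ω => Y ω j; P] = C i j)
    (hV : ∀ i j, cov[fun ω => Y ω i, fun ω => Y ω j; P] = V i j) :
    HasMoments (P.map fun ω => toEuclideanLin A (X ω) + toEuclideanLin B (Y ω))
      (toEuclideanLin A m + toEuclideanLin B v)
      (A * S * Aᵀ + A * C * Bᵀ + B * Cᵀ * Aᵀ + B * V * Bᵀ) := by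
  have hA : Continuous (toEuclideanLin A) := LinearMap.continuous_of_finiteDimensional _
  have hB : Continuous (toEuclideanLin B) := LinearMap.continuous_of_finiteDimensional _
  have hAX : MemLp (fun ω => toEuclideanLin A (X ω)) 2 P :=
    (LinearMap.toContinuousLinearMap (toEuclideanLin A)).comp_memLp' hX2
  have hBY : MemLp (fun ω => toEuclideanLin B (Y ω)) 2 P :=
    (LinearMap.toContinuousLinearMap (toEuclideanLin B)).comp_memLp' hY2
  have hXi := memLp_coord hX2
  have hYi := memLp_coord hY2
  have hAi (i : Fin n) (x : EuclideanSpace ℝ (Fin d)) : toEuclideanLin A x i = ∑ k, A i k * x k :=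
    rfl
  have hBi (i : Fin n) (x : EuclideanSpace ℝ (Fin d')) :
    toEuclideanLin B x i = ∑ k, B i k * x k := rfl
  have hmeas : Measurable fun ω => toEuclideanLin A (X ω) + toEuclideanLin B (Y ω) :=
    (hA.measurable.comp hX).add (hB.measurable.comp hY)
  refine hasMoments_map hmeas (hAX.add hBY)
    (fun i => ?_) (fun i j => ?_)
  · simp only [PiLp.add_apply, hAi, hBi]
    rw [integral_add, integral_finsetSum, integral_finsetSum]
    · simp [integral_const_mul, hm, hv]
    · exact fun k _ => ((hYi k).integrable one_le_two).const_mul _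
    · exact fun k _ => ((hXi k).integrable one_le_two).const_mul _
    · exact integrable_finsetSum _ fun k _ => ((hXi k).integrable one_le_two).const_mul _
    · exact integrable_finsetSum _ fun k _ => ((hYi k).integrable one_le_two).const_mul _
  · simp only [PiLp.add_apply, hAi, hBi]
    have hA2 (i : Fin n) : MemLp (fun ω => ∑ k, A i k * X ω k) 2 P :=
      memLp_finsetSum _ fun k _ => (hXi k).const_mul _
    have hB2 (i : Fin n) : MemLp (fun ω => ∑ k, B i k * Y ω k) 2 P :=
      memLp_finsetSum _ fun k _ => (hYi k).const_mul _
    have e (i : Fin n) : (fun ω => ∑ k, A i k * X ω k + ∑ k, B i k * Y ω k) =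
      (fun ω => ∑ k, A i k * X ω k) + (fun ω => ∑ k, B i k * Y ω k) := rfl
    have hX' (i k) := (hXi k).const_mul (A i k)
    have hY' (i k) := (hYi k).const_mul (B i k)
    rw [e, e, covariance_add_left (hA2 i) (hB2 i) ((hA2 j).add (hB2 j)),
      covariance_add_right (hA2 i) (hA2 j) (hB2 j), covariance_add_right (hB2 i) (hA2 j) (hB2 j),
      covariance_fun_sum_fun_sum (hX' i) (hX' j), covariance_fun_sum_fun_sum (hX' i) (hY' j),
      covariance_fun_sum_fun_sum (hY' i) (hX' j), covariance_fun_sum_fun_sum (hY' i) (hY' j)]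
    have hC' (i j) : cov[fun ω => Y ω i, fun ω => X ω j; P] = C j i := by
      rw [covariance_comm, hC]
    simp only [covariance_const_mul_left, covariance_const_mul_right, hS, hC, hV, hC', Matrix.add_apply,
      mul_mul_transpose_apply]
    simp only [transpose_apply]
    rw [← add_assoc]

end UDC

/-! ### Divergences from a Gaussian reference -/

namespace UDC

open InformationTheory

variable {n : ℕ}

/-- The Kullback-Leibler divergence of `N(m, S)` with respect to `N(m₁, S₁)`. -/
noncomputable def gaussianKL (m : EuclideanSpace ℝ (Fin n)) (S : Matrix (Fin n) (Fin n) ℝ)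
    (m₁ : EuclideanSpace ℝ (Fin n)) (S₁ : Matrix (Fin n) (Fin n) ℝ) : ℝ :=
  1 / 2 * ((S₁⁻¹ * S).trace + (m - m₁).ofLp ⬝ᵥ S₁⁻¹ *ᵥ (m - m₁).ofLp - n
    + Real.log S₁.det - Real.log S.det)

lemma hasMoments_multivariateGaussian (m : EuclideanSpace ℝ (Fin n))
    {S : Matrix (Fin n) (Fin n) ℝ} (hS : S.PosSemidef) :
    HasMoments (multivariateGaussian m S) m S where
  prob := inferInstance
  memLp := IsGaussian.memLp_two_id
  mean i := by
    have h := ContinuousLinearMap.integral_comp_id_comm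
      (IsGaussian.integrable_id (μ := multivariateGaussian m S))
      (EuclideanSpace.proj i : EuclideanSpace ℝ (Fin n) →L[ℝ] ℝ)
    simpa using h
  cov i j := covariance_eval_multivariateGaussian hS i j

variable {p : Measure (EuclideanSpace ℝ (Fin n))} {m m₁ : EuclideanSpace ℝ (Fin n)}
  {S S₁ : Matrix (Fin n) (Fin n) ℝ}

lemma HasMoments.integrable_logGaussianPDF (h : HasMoments p m S)
    (m₁ : EuclideanSpace ℝ (Fin n)) (S₁ : Matrix (Fin n) (Fin n) ℝ) :
    Integrable (logGaussianPDF m₁ S₁) p := by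
  have := h.prob
  exact (((h.integrable_quadratic S₁⁻¹ m₁).const_mul _).sub (integrable_const _)).sub
    (integrable_const _)

lemma HasMoments.integral_logGaussianPDF (h : HasMoments p m S)
    (m₁ : EuclideanSpace ℝ (Fin n)) (S₁ : Matrix (Fin n) (Fin n) ℝ) :
    ∫ x, logGaussianPDF m₁ S₁ x ∂p =
      -(1 / 2) * ((S₁⁻¹ * S).trace + (m - m₁).ofLp ⬝ᵥ S₁⁻¹ *ᵥ (m - m₁).ofLp)
        - 1 / 2 * Real.log S₁.det - n / 2 * Real.log (2 * Real.pi) := by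
  have := h.prob
  unfold logGaussianPDF
  have hi := (h.integrable_quadratic S₁⁻¹ m₁).const_mul (-(1 / 2))
  have hi2 : Integrable (fun x => -(1 / 2) * ((x - m₁).ofLp ⬝ᵥ S₁⁻¹ *ᵥ (x - m₁).ofLp) -
      1 / 2 * Real.log S₁.det) p := hi.sub (integrable_const _)
  rw [integral_sub hi2 (integrable_const _),
    integral_sub hi (integrable_const _), integral_const_mul, h.integral_quadratic]
  simp

lemma HasMoments.integral_logGaussianPDF_sub (h : HasMoments p m S) (hS : S.PosDef)
    (m₁ : EuclideanSpace ℝ (Fin n)) (S₁ : Matrix (Fin n) (Fin n) ℝ) :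
    ∫ x, (logGaussianPDF m S x - logGaussianPDF m₁ S₁ x) ∂p = gaussianKL m S m₁ S₁ := by
  rw [integral_sub (h.integrable_logGaussianPDF _ _) (h.integrable_logGaussianPDF _ _),
    h.integral_logGaussianPDF, h.integral_logGaussianPDF,
    nonsing_inv_mul _ (isUnit_iff_ne_zero.2 hS.det_pos.ne'), gaussianKL]
  simp
  ring

/-- One Gaussian is an exponential tilting of the other by the difference of log-densities, with
normalizing constant 1. In this form the change-of-reference formulas for `llr` under tilting apply.
-/
lemma integral_exp_logGaussianPDF_sub (hS : S.PosDef) (hS₁ : S₁.PosDef) :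
    Integrable (fun x => Real.exp (logGaussianPDF m S x - logGaussianPDF m₁ S₁ x))
      (multivariateGaussian m₁ S₁) ∧
    ∫ x, Real.exp (logGaussianPDF m S x - logGaussianPDF m₁ S₁ x) ∂multivariateGaussian m₁ S₁ = 1 ∧
    multivariateGaussian m S = (multivariateGaussian m₁ S₁).tilted
      (fun x => logGaussianPDF m S x - logGaussianPDF m₁ S₁ x) := by
  have hd : multivariateGaussian m S = (multivariateGaussian m₁ S₁).withDensity fun x =>
      ENNReal.ofReal (Real.exp (logGaussianPDF m S x - logGaussianPDF m₁ S₁ x)) := by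
    rw [multivariateGaussian_eq_withDensity m₁ hS₁, multivariateGaussian_eq_withDensity m hS,
      ← withDensity_mul _ (by fun_prop) (by fun_prop)]
    congr 1
    ext x
    rw [Pi.mul_apply, ← ENNReal.ofReal_mul (Real.exp_pos _).le, ← Real.exp_add]
    congr 2
    ring
  have hl : ∫⁻ x, ENNReal.ofReal (Real.exp (logGaussianPDF m S x - logGaussianPDF m₁ S₁ x))
      ∂multivariateGaussian m₁ S₁ = 1 := by
    have := congrArg (fun μ => μ Set.univ) hd
    simpa using this.symm
  have hint : ∫ x, Real.exp (logGaussianPDF m S x - logGaussianPDF m₁ S₁ x)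
      ∂multivariateGaussian m₁ S₁ = 1 := by
    rw [integral_eq_lintegral_of_nonneg_ae (ae_of_all _ fun x => (Real.exp_pos _).le)
      (Measurable.aestronglyMeasurable (by fun_prop)), hl, ENNReal.toReal_one]
  refine ⟨?_, hint, ?_⟩
  -- A non-integrable function has integral 0 by convention, so the value 1 already forces
  -- integrability.
  · by_contra hn
    rw [integral_undef hn] at hint
    exact zero_ne_one hint
  · rw [Measure.tilted, hint, hd]
    simp

/-- Passing from the reference to the Gaussian with the moments of `p` changes the integrated
log-likelihood ratio by the integral of a quadratic polynomial, which is `gaussianKL m S m₁ S₁`.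
What is left over is the divergence of `p` from that Gaussian, which is nonnegative. -/
lemma HasMoments.gaussianKL_le_integral_llr (h : HasMoments p m S) (hS : S.PosDef)
    (hS₁ : S₁.PosDef) (hac : p ≪ multivariateGaussian m₁ S₁)
    (hint : Integrable (llr p (multivariateGaussian m₁ S₁)) p) :
    gaussianKL m S m₁ S₁ ≤ ∫ x, llr p (multivariateGaussian m₁ S₁) x ∂p := by
  have := h.prob
  obtain ⟨h1, h2, h3⟩ := integral_exp_logGaussianPDF_sub (m := m) (m₁ := m₁) hS hS₁
  have hi : Integrable (fun x => logGaussianPDF m S x - logGaussianPDF m₁ S₁ x) p :=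
    (h.integrable_logGaussianPDF _ _).sub (h.integrable_logGaussianPDF _ _)
  have e := integral_llr_tilted_right hac hi h1 hint
  have hac' := hac.trans (absolutelyContinuous_tilted h1)
  have hint' := integrable_llr_tilted_right hac hi hint h1
  rw [← h3] at hac' hint' e
  have hnn := integral_llr_add_sub_measure_univ_nonneg hac' hint'
  rw [h2, Real.log_one, h.integral_logGaussianPDF_sub hS] at e
  simp only [probReal_univ] at hnn
  linarith

lemma multivariateGaussian_llr (m m₁ : EuclideanSpace ℝ (Fin n)) (hS : S.PosDef) (hS₁ : S₁.PosDef) :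
    multivariateGaussian m S ≪ multivariateGaussian m₁ S₁ ∧
    Integrable (llr (multivariateGaussian m S) (multivariateGaussian m₁ S₁))
      (multivariateGaussian m S) ∧
    ∫ x, llr (multivariateGaussian m S) (multivariateGaussian m₁ S₁) x
      ∂multivariateGaussian m S = gaussianKL m S m₁ S₁ := by
  have h := hasMoments_multivariateGaussian m hS.posSemidef
  obtain ⟨h1, h2, h3⟩ := integral_exp_logGaussianPDF_sub (m := m) (m₁ := m₁) hS hS₁
  have hac : multivariateGaussian m S ≪ multivariateGaussian m₁ S₁ := by
    rw [h3]; exact tilted_absolutelyContinuous _ _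
  have hllr := llr_tilted_left (Measure.AbsolutelyContinuous.refl (multivariateGaussian m₁ S₁)) h1
    (Measurable.aemeasurable (by fun_prop))
  rw [← h3, h2, Real.log_one] at hllr
  have hllr2 : llr (multivariateGaussian m S) (multivariateGaussian m₁ S₁)
      =ᵐ[multivariateGaussian m S] fun x => logGaussianPDF m S x - logGaussianPDF m₁ S₁ x := by
    filter_upwards [hac hllr, hac (llr_self (multivariateGaussian m₁ S₁))] with x hx hx2
    rw [hx, hx2]
    simp
  refine ⟨hac, ?_, ?_⟩
  · rw [integrable_congr hllr2]
    exact (h.integrable_logGaussianPDF _ _).sub (h.integrable_logGaussianPDF _ _)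
  · rw [integral_congr_ae hllr2, h.integral_logGaussianPDF_sub hS]

lemma gaussianKL_nonneg (m m₁ : EuclideanSpace ℝ (Fin n)) (hS : S.PosDef) (hS₁ : S₁.PosDef) :
    0 ≤ gaussianKL m S m₁ S₁ := by
  obtain ⟨h1, h2, h3⟩ := multivariateGaussian_llr m m₁ hS hS₁
  have := integral_llr_add_sub_measure_univ_nonneg h1 h2
  simp only [probReal_univ, h3] at this
  linarith

/-- If `x` were a nonzero null direction of `S`, the variance along `x` would vanish and `p` would
live on a hyperplane through `m`, a Lebesgue null set. -/
lemma HasMoments.posDef (h : HasMoments p m S) (hp : p ≪ volume) : S.PosDef := by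
  have := h.prob
  refine PosDef.of_dotProduct_mulVec_pos h.posSemidef.1 fun x hx => ?_
  refine lt_of_le_of_ne (h.posSemidef.dotProduct_mulVec_nonneg x) fun h0 => ?_
  have hq (y : EuclideanSpace ℝ (Fin n)) : (y - m).ofLp ⬝ᵥ vecMulVec x x *ᵥ (y - m).ofLp =
      (x ⬝ᵥ (y - m).ofLp) ^ 2 := by
    rw [vecMulVec_mulVec, op_smul_eq_smul, dotProduct_smul, smul_eq_mul, dotProduct_comm _ x, sq]
  have hi := h.integrable_quadratic (vecMulVec x x) m
  have hz := h.integral_quadratic (vecMulVec x x) m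
  have ht : (vecMulVec x x * S).trace = 0 := by
    rw [vecMulVec_mul, trace_vecMulVec, dotProduct_comm, ← dotProduct_mulVec]
    exact h0.symm
  rw [ht, sub_self, WithLp.ofLp_zero, zero_dotProduct, add_zero] at hz
  simp_rw [hq] at hz hi
  rw [integral_eq_zero_iff_of_nonneg (fun y => sq_nonneg _) hi] at hz
  set L : EuclideanSpace ℝ (Fin n) →ₗ[ℝ] ℝ := (innerSL ℝ (WithLp.toLp 2 x)).toLinearMap with hL
  have hLa (y : EuclideanSpace ℝ (Fin n)) : L y = x ⬝ᵥ y.ofLp := by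
    simp [hL, EuclideanSpace.inner_eq_star_dotProduct, dotProduct_comm]
  have hnull : volume (AffineSubspace.mk' m (LinearMap.ker L) : Set (EuclideanSpace ℝ (Fin n))) = 0 := by
    refine Measure.addHaar_affineSubspace _ _ fun htop => ?_
    have hd := AffineSubspace.direction_mk' m (LinearMap.ker L)
    rw [htop, AffineSubspace.direction_top] at hd
    have hx0 : WithLp.toLp 2 x ∈ LinearMap.ker L := hd ▸ Submodule.mem_top
    rw [LinearMap.mem_ker, hLa] at hx0
    exact hx (dotProduct_self_eq_zero.1 hx0)
  have hae : ∀ᵐ y ∂p, False := by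
    filter_upwards [hz, measure_eq_zero_iff_ae_notMem.1 (hp hnull)] with y h1 h2
    refine h2 ?_
    rw [SetLike.mem_coe, AffineSubspace.mem_mk', LinearMap.mem_ker, vsub_eq_sub, hLa]
    exact pow_eq_zero_iff two_ne_zero |>.1 h1
  rw [Filter.eventually_false_iff_eq_bot, ae_eq_bot] at hae
  exact IsProbabilityMeasure.ne_zero p hae

section Scaling

variable {Ω : Type*} [MeasurableSpace Ω] {μ ν : Measure Ω} [IsProbabilityMeasure μ]
  [IsProbabilityMeasure ν] {c a : ℝ}

lemma llr_smul_smul (hac : μ ≪ ν) (hc : 0 < c) (ha : 0 < a) :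
    llr (ENNReal.ofReal c • μ) (ENNReal.ofReal a • ν) =ᵐ[μ]
      fun x => llr μ ν x + Real.log (c / a) := by
  have hc' : ENNReal.ofReal c ≠ 0 := by simpa using hc
  have ha' : ENNReal.ofReal a ≠ 0 := by simpa using ha
  have := Measure.smul_finite ν (c := ENNReal.ofReal a) ENNReal.ofReal_ne_top
  filter_upwards [llr_smul_left (hac.trans (Measure.absolutelyContinuous_smul ha')) _ hc'
    ENNReal.ofReal_ne_top, llr_smul_right hac _ ha' ENNReal.ofReal_ne_top] with x h1 h2
  rw [h1, h2, ENNReal.toReal_ofReal hc.le, ENNReal.toReal_ofReal ha.le,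
    Real.log_div hc.ne' ha.ne']
  ring

/-- The Kullback-Leibler divergence between scaled probability measures. -/
lemma klDiv_smul_smul (hac : μ ≪ ν) (hint : Integrable (llr μ ν) μ) (hc : 0 < c) (ha : 0 < a) :
    klDiv (ENNReal.ofReal c • μ) (ENNReal.ofReal a • ν) =
      ENNReal.ofReal (c * ∫ x, llr μ ν x ∂μ + (c * Real.log (c / a) + a - c)) := by
  have ha' : ENNReal.ofReal a ≠ 0 := by simpa using ha
  have hac' : ENNReal.ofReal c • μ ≪ ENNReal.ofReal a • ν :=
    (hac.smul_left _).trans (Measure.absolutelyContinuous_smul ha')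
  have hll := llr_smul_smul hac hc ha
  have hint0 : Integrable (llr (ENNReal.ofReal c • μ) (ENNReal.ofReal a • ν)) μ := by
    rw [integrable_congr hll]; exact hint.add (integrable_const _)
  rw [klDiv_of_ac_of_integrable hac' (hint0.smul_measure ENNReal.ofReal_ne_top)]
  rw [integral_smul_measure, integral_congr_ae hll, integral_add hint (integrable_const _)]
  simp [ENNReal.toReal_ofReal, hc.le, ha.le, measureReal_def]
  ring_nf

/-- Scaling both measures only adds a constant to the log-likelihood ratio, so finiteness of the
divergence descends to the normalized measures. -/
lemma klDiv_smul_smul_ne_top (hc : 0 < c) (ha : 0 < a)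
    (h : klDiv (ENNReal.ofReal c • μ) (ENNReal.ofReal a • ν) ≠ ∞) :
    μ ≪ ν ∧ Integrable (llr μ ν) μ := by
  have hc' : ENNReal.ofReal c ≠ 0 := by simpa using hc
  obtain ⟨h1, h2⟩ := klDiv_ne_top_iff.1 h
  have hac : μ ≪ ν := (Measure.absolutelyContinuous_smul hc').trans
    (h1.trans Measure.smul_absolutelyContinuous)
  rw [integrable_smul_measure hc' ENNReal.ofReal_ne_top,
    integrable_congr (llr_smul_smul hac hc ha)] at h2
  exact ⟨hac, (h2.sub (integrable_const (Real.log (c / a)))).congr (ae_of_all _ fun x => by simp)⟩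

end Scaling

end UDC

/-! ### Realizing joint moments by affine-Gaussian laws -/

namespace UDC

/-- The regression matrix of a positive semidefinite block matrix, and its Schur complement. -/
lemma exists_regression {d d' : ℕ} {S : Matrix (Fin d) (Fin d) ℝ} {C : Matrix (Fin d) (Fin d') ℝ}
    {V : Matrix (Fin d') (Fin d') ℝ} (hW : (fromBlocks S C Cᵀ V).PosSemidef) :
    ∃ K : Matrix (Fin d') (Fin d) ℝ, K * S = Cᵀ ∧ S * Kᵀ = C ∧ (V - K * S * Kᵀ).PosSemidef := by
  have hS : Sᵀ = S := by
    have := hW.1.eq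
    rw [conjTranspose_eq_transpose_of_trivial, fromBlocks_transpose, fromBlocks_inj] at this
    exact this.1
  -- `S` may be singular, so solvability has to come from semidefiniteness of the block matrix. If
  -- `S z = 0`, then `(z, 0)` is a zero of the block quadratic form, hence in the kernel of the
  -- block matrix, so `Cᵀ z = 0`. The columns of `C` are thus orthogonal to the kernel of `S`, which
  -- means they lie in its range.
  have hcol (k : Fin d') : ∃ y : EuclideanSpace ℝ (Fin d), S *ᵥ y.ofLp = fun i => C i k := by
    have hmem : WithLp.toLp 2 (fun i => C i k) ∈ (LinearMap.ker (toEuclideanLin S))ᗮ := by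
      rw [Submodule.mem_orthogonal]
      intro z hz
      have hz' : S *ᵥ z.ofLp = 0 := congrArg WithLp.ofLp (LinearMap.mem_ker.1 hz)
      have h0 := (hW.dotProduct_mulVec_zero_iff (Sum.elim z.ofLp 0)).1 (by
        rw [fromBlocks_mulVec]
        simp [dotProduct, hz', Function.comp_def, show (fun _ : Fin d' => (0 : ℝ)) = 0 from rfl])
      rw [fromBlocks_mulVec] at h0
      have h1 := congrFun h0 (Sum.inr k)
      simp only [Sum.elim_inr, Function.comp_def, Sum.elim_inl, Pi.zero_apply, Pi.add_apply] at h1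
      have h2 : (fun x : Fin d' => (0 : ℝ)) = 0 := rfl
      rw [h2, mulVec_zero, Pi.zero_apply, add_zero] at h1
      rw [EuclideanSpace.inner_eq_star_dotProduct]
      exact h1
    rw [LinearMap.orthogonal_ker, ← toEuclideanLin_conjTranspose_eq_adjoint,
      conjTranspose_eq_transpose_of_trivial, hS] at hmem
    obtain ⟨y, hy⟩ := hmem
    exact ⟨y, congrArg WithLp.ofLp hy⟩
  choose y hy using hcol
  have hSK : S * (Matrix.of fun k i => y k i)ᵀ = C := by
    ext i k
    exact congrFun (hy k) i
  have hKS : (Matrix.of fun k i => y k i) * S = Cᵀ := by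
    rw [← hSK, transpose_mul, transpose_transpose, hS]
  refine ⟨_, hKS, hSK, ?_⟩
  set K : Matrix (Fin d') (Fin d) ℝ := Matrix.of fun k i => y k i
  -- Compressing the block matrix by `(-K, 1)` gives the covariance of the residual `u - K x`, which
  -- is the Schur complement.
  have := hW.mul_mul_conjTranspose_same (fromCols (-K) 1)
  rw [conjTranspose_eq_transpose_of_trivial, transpose_fromCols, fromCols_mul_fromBlocks,
    fromCols_mul_fromRows] at this
  rw [Matrix.mul_assoc, hSK]
  convert this using 1
  rw [Matrix.neg_mul, Matrix.neg_mul, hKS, Matrix.one_mul, Matrix.one_mul, neg_add_cancel,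
    Matrix.zero_mul, zero_add, transpose_one, Matrix.mul_one]
  abel

lemma toEuclideanLin_mul_apply {k l n : ℕ} (M : Matrix (Fin k) (Fin l) ℝ)
    (N : Matrix (Fin l) (Fin n) ℝ) (x : EuclideanSpace ℝ (Fin n)) :
    toEuclideanLin (M * N) x = toEuclideanLin M (toEuclideanLin N x) := by
  ext i
  exact congrFun (mulVec_mulVec x.ofLp M N).symm i

/-- The affine-Gaussian kernel `x ↦ N(K x + v, Q)`. -/
noncomputable def affineGaussianKernel {d d' : ℕ} (K : Matrix (Fin d') (Fin d) ℝ)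
    (v : EuclideanSpace ℝ (Fin d')) (Q : Matrix (Fin d') (Fin d') ℝ) :
    Kernel (EuclideanSpace ℝ (Fin d)) (EuclideanSpace ℝ (Fin d')) :=
  (Kernel.id ×ₖ Kernel.const _ (multivariateGaussian v Q)).map
    fun q => toEuclideanLin K q.1 + q.2

section

variable {d d' : ℕ} (K : Matrix (Fin d') (Fin d) ℝ) (v : EuclideanSpace ℝ (Fin d'))
  (Q : Matrix (Fin d') (Fin d') ℝ)

@[fun_prop]
lemma measurable_toEuclideanLin {k l : ℕ} (M : Matrix (Fin k) (Fin l) ℝ) :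
    Measurable (toEuclideanLin M) :=
  (LinearMap.continuous_of_finiteDimensional _).measurable

lemma affineGaussianKernel_apply' (x : EuclideanSpace ℝ (Fin d)) :
    affineGaussianKernel K v Q x =
      (multivariateGaussian v Q).map fun y => toEuclideanLin K x + y := by
  rw [affineGaussianKernel, Kernel.map_apply _ (by fun_prop), Kernel.prod_apply, Kernel.id_apply,
    Kernel.const_apply, Measure.dirac_prod, Measure.map_map (by fun_prop) (by fun_prop)]
  rfl

lemma affineGaussianKernel_apply (x : EuclideanSpace ℝ (Fin d)) :
    affineGaussianKernel K v Q x = multivariateGaussian (toEuclideanLin K x + v) Q := by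
  rw [affineGaussianKernel_apply', multivariateGaussian, multivariateGaussian,
    Measure.map_map (by fun_prop) (by fun_prop)]
  congr 1
  ext1 y
  simp [add_assoc]

instance : IsMarkovKernel (affineGaussianKernel K v Q) :=
  ⟨fun x => by rw [affineGaussianKernel_apply]; infer_instance⟩

/-- The control is `K x` plus Gaussian noise independent of the state, so the joint law is a linear
image of a product measure; Gaussianity and moments can then be read off. -/
lemma compProd_affineGaussianKernel (μ : Measure (EuclideanSpace ℝ (Fin d))) [IsFiniteMeasure μ] :
    μ ⊗ₘ affineGaussianKernel K v Q =
      (μ.prod (multivariateGaussian v Q)).map fun q => (q.1, toEuclideanLin K q.1 + q.2) := by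
  refine Measure.ext_of_lintegral _ fun f hf => ?_
  rw [Measure.lintegral_compProd hf, lintegral_map hf (by fun_prop),
    lintegral_prod _ (by fun_prop)]
  refine lintegral_congr fun x => ?_
  rw [affineGaussianKernel_apply', lintegral_map (by fun_prop) (by fun_prop)]

end

lemma HasMoments.eq_multivariateGaussian {n : ℕ} {p : Measure (EuclideanSpace ℝ (Fin n))}
    [IsGaussian p] {m : EuclideanSpace ℝ (Fin n)} {S : Matrix (Fin n) (Fin n) ℝ}
    (h : HasMoments p m S) : p = multivariateGaussian m S := by
  have hg := hasMoments_multivariateGaussian m h.posSemidef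
  refine IsGaussian.ext ?_ ?_
  · rw [integral_id_multivariateGaussian']
    ext i
    have h1 := ContinuousLinearMap.integral_comp_id_comm (IsGaussian.integrable_id (μ := p))
      (EuclideanSpace.proj i : EuclideanSpace ℝ (Fin n) →L[ℝ] ℝ)
    have h2 := h.mean i
    simp only [EuclideanSpace.coe_proj] at h1
    simpa [h2] using h1.symm
  · rw [← ContinuousLinearMap.toBilinForm_inj]
    refine LinearMap.BilinForm.ext_basis (EuclideanSpace.basisFun (Fin n) ℝ).toBasis fun i j ↦ ?_
    rw [ContinuousLinearMap.toBilinForm_apply, ContinuousLinearMap.toBilinForm_apply,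
      covarianceBilin_apply_eq_cov h.memLp, covarianceBilin_apply_eq_cov hg.memLp]
    have (i : Fin n) : (fun u => inner ℝ ((EuclideanSpace.basisFun (Fin n) ℝ).toBasis i) u) =
        fun u : EuclideanSpace ℝ (Fin n) => u i := by ext; simp [PiLp.inner_apply]
    simp_rw [this, h.cov, hg.cov]

section

variable {d d' : ℕ} (A : Matrix (Fin d) (Fin d) ℝ) (B : Matrix (Fin d) (Fin d') ℝ)
  (m : EuclideanSpace ℝ (Fin d)) (v : EuclideanSpace ℝ (Fin d'))
  {S : Matrix (Fin d) (Fin d) ℝ} {C : Matrix (Fin d) (Fin d') ℝ} {V : Matrix (Fin d') (Fin d') ℝ}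

/-- A Gaussian step with prescribed joint moments is realized by an affine-Gaussian kernel. -/
lemma exists_affineGaussian_step (hW : (fromBlocks S C Cᵀ V).PosSemidef) :
    ∃ U : Kernel (EuclideanSpace ℝ (Fin d)) (EuclideanSpace ℝ (Fin d')),
      IsMarkovKernel U ∧ IsAffineGaussian U ∧
      (multivariateGaussian m S ⊗ₘ U).map
          (fun q => toEuclideanLin A q.1 + toEuclideanLin B q.2) =
        multivariateGaussian (toEuclideanLin A m + toEuclideanLin B v)
          (A * S * Aᵀ + A * C * Bᵀ + B * Cᵀ * Aᵀ + B * V * Bᵀ) ∧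
      ∫⁻ x, ∫⁻ u, ‖u‖ₑ ^ 2 ∂U x ∂multivariateGaussian m S =
        ENNReal.ofReal (‖v‖ ^ 2 + V.trace) := by
  obtain ⟨K, hKS, hSK, hQ⟩ := exists_regression hW
  set Q := V - K * S * Kᵀ with hQdef
  have hSp : S.PosSemidef := by
    have := hW.submatrix Sum.inl
    rwa [show (fromBlocks S C Cᵀ V).submatrix Sum.inl Sum.inl = S from by ext; rfl] at this
  -- The offset is chosen so that the control `K x + w + noise` has mean `v`.
  set w := v - toEuclideanLin K m with hw
  have hm := hasMoments_multivariateGaussian m hSp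
  have hv := hasMoments_multivariateGaussian w hQ
  set P := (multivariateGaussian m S).prod (multivariateGaussian w Q) with hP
  have hfst : P.map Prod.fst = multivariateGaussian m S := by simp [hP]
  have hsnd : P.map Prod.snd = multivariateGaussian w Q := by simp [hP]
  have hX2 : MemLp Prod.fst 2 P := hm.memLp.comp_fst _
  have hY2 : MemLp Prod.snd 2 P := hv.memLp.comp_snd _
  rw [← hfst] at hm
  rw [← hsnd] at hv
  -- This is used twice: with `(A + B * K, B)` for the next state and with `(K, 1)` for the control
  -- itself.
  have hadd {k : ℕ} (M : Matrix (Fin k) (Fin d) ℝ) (N : Matrix (Fin k) (Fin d') ℝ) :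
      HasMoments (P.map fun q => toEuclideanLin M q.1 + toEuclideanLin N q.2)
        (toEuclideanLin M m + toEuclideanLin N w) (M * S * Mᵀ + N * Q * Nᵀ) := by
    have h := hasMoments_map_add measurable_fst measurable_snd hX2 hY2 M N
      (hm.mean_of_map measurable_fst) (hv.mean_of_map measurable_snd)
      (hm.cov_of_map measurable_fst) (C := 0) (fun i j => covariance_fst_snd_prod
        (memLp_coord (X := id) (hasMoments_multivariateGaussian m hSp).memLp i)
        (memLp_coord (X := id) (hasMoments_multivariateGaussian w hQ).memLp j))
        (hv.cov_of_map measurable_snd)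
    simpa using h
  refine ⟨affineGaussianKernel K w Q, inferInstance,
    ⟨K, w, Q, hQ, affineGaussianKernel_apply K w Q⟩, ?_, ?_⟩
  · have h := hadd (A + B * K) B
    have hcomp : (multivariateGaussian m S ⊗ₘ affineGaussianKernel K w Q).map
        (fun q => toEuclideanLin A q.1 + toEuclideanLin B q.2) =
        P.map fun q => toEuclideanLin (A + B * K) q.1 + toEuclideanLin B q.2 := by
      rw [compProd_affineGaussianKernel, Measure.map_map (by fun_prop) (by fun_prop)]
      congr 1
      ext1 q
      simp only [Function.comp_apply, map_add, LinearMap.add_apply]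
      rw [toEuclideanLin_mul_apply]
      abel
    have hmean : toEuclideanLin (A + B * K) m + toEuclideanLin B w =
        toEuclideanLin A m + toEuclideanLin B v := by
      rw [hw, map_add, LinearMap.add_apply, map_sub, toEuclideanLin_mul_apply]
      abel
    have hcov : (A + B * K) * S * (A + B * K)ᵀ + B * Q * Bᵀ =
        A * S * Aᵀ + A * C * Bᵀ + B * Cᵀ * Aᵀ + B * V * Bᵀ := by
      rw [hQdef, ← hKS, ← hSK]
      simp only [transpose_add, transpose_mul, Matrix.add_mul, Matrix.mul_add, Matrix.mul_sub,
        Matrix.sub_mul, Matrix.mul_assoc]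
      abel
    have hG : IsGaussian (P.map fun q => toEuclideanLin (A + B * K) q.1 + toEuclideanLin B q.2) :=
      isGaussian_map (μ := P)
        ((LinearMap.toContinuousLinearMap (toEuclideanLin (A + B * K))).coprod
          (LinearMap.toContinuousLinearMap (toEuclideanLin B)))
    rw [hcomp, h.eq_multivariateGaussian, hmean, hcov]
  · have h := (hadd K 1).lintegral_enorm_sq
    have hone (y : EuclideanSpace ℝ (Fin d')) :
        toEuclideanLin (1 : Matrix (Fin d') (Fin d') ℝ) y = y := congrArg (WithLp.toLp 2) (one_mulVec _)
    have hV : K * S * Kᵀ + Q = V := by rw [hQdef]; abel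
    simp only [hone, one_mul, transpose_one, mul_one, hV] at h
    rw [hw, add_sub_cancel, lintegral_map (by fun_prop) (by fun_prop),
      lintegral_prod _ (by fun_prop)] at h
    rw [← h]
    refine lintegral_congr fun x => ?_
    rw [affineGaussianKernel_apply', lintegral_map (by fun_prop) (by fun_prop)]

end

end UDC

/-! ### Moment dynamics and their correspondence with plans -/

namespace UDC

variable {d d' : ℕ}

/-- The mean and covariance of the state and the control effort that can be produced in a given
number of steps, starting from mean `m` and covariance `S`. -/
inductive Reach (A : Matrix (Fin d) (Fin d) ℝ) (B : Matrix (Fin d) (Fin d') ℝ)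
    (m : EuclideanSpace ℝ (Fin d)) (S : Matrix (Fin d) (Fin d) ℝ) :
    ℕ → EuclideanSpace ℝ (Fin d) → Matrix (Fin d) (Fin d) ℝ → ℝ → Prop
  | zero : Reach A B m S 0 m S 0
  | step {N : ℕ} {m' : EuclideanSpace ℝ (Fin d)} {S' : Matrix (Fin d) (Fin d) ℝ} {e : ℝ}
      (h : Reach A B m S N m' S' e) (v : EuclideanSpace ℝ (Fin d'))
      (C : Matrix (Fin d) (Fin d') ℝ) (V : Matrix (Fin d') (Fin d') ℝ)
      (hW : (fromBlocks S' C Cᵀ V).PosSemidef) :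
      Reach A B m S (N + 1) (toEuclideanLin A m' + toEuclideanLin B v)
        (A * S' * Aᵀ + A * C * Bᵀ + B * Cᵀ * Aᵀ + B * V * Bᵀ) (e + (‖v‖ ^ 2 + V.trace))

variable {A : Matrix (Fin d) (Fin d) ℝ} {B : Matrix (Fin d) (Fin d') ℝ}
  {m m' : EuclideanSpace ℝ (Fin d)} {S S' : Matrix (Fin d) (Fin d) ℝ} {N : ℕ} {e : ℝ}

lemma posSemidef_toBlocks₂₂ {S : Matrix (Fin d) (Fin d) ℝ} {C : Matrix (Fin d) (Fin d') ℝ}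
    {V : Matrix (Fin d') (Fin d') ℝ} (hW : (fromBlocks S C Cᵀ V).PosSemidef) : V.PosSemidef := by
  have := hW.submatrix Sum.inr
  rwa [show (fromBlocks S C Cᵀ V).submatrix Sum.inr Sum.inr = V from by ext; rfl] at this

lemma Reach.nonneg (h : Reach A B m S N m' S' e) : 0 ≤ e := by
  induction h with
  | zero => exact le_rfl
  | step h v C V hW ih =>
    have := (posSemidef_toBlocks₂₂ hW).trace_nonneg
    positivity

/-- The updated covariance is the joint covariance of state and control compressed by `(A, B)`. -/
lemma Reach.posSemidef (h : Reach A B m S N m' S' e) (hS : S.PosSemidef) : S'.PosSemidef := by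
  induction h with
  | zero => exact hS
  | step h v C V hW ih =>
    have := hW.mul_mul_conjTranspose_same (fromCols A B)
    rw [conjTranspose_eq_transpose_of_trivial, transpose_fromCols, fromCols_mul_fromBlocks,
      fromCols_mul_fromRows] at this
    convert this using 1
    simp only [Matrix.add_mul]
    abel

lemma stateMeasure_congr {π : Measure (EuclideanSpace ℝ (Fin d))}
    {U U' : ℕ → Kernel (EuclideanSpace ℝ (Fin d)) (EuclideanSpace ℝ (Fin d'))} {N : ℕ}
    (h : ∀ t < N, U t = U' t) : stateMeasure A B π U N = stateMeasure A B π U' N := by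
  induction N with
  | zero => rfl
  | succ N ih => rw [stateMeasure, stateMeasure, ih fun t ht => h t (by omega), h N (by omega)]

/-- The control effort of the step at time `t`. -/
noncomputable def stepEffort (A : Matrix (Fin d) (Fin d) ℝ) (B : Matrix (Fin d) (Fin d') ℝ)
    (π : Measure (EuclideanSpace ℝ (Fin d)))
    (U : ℕ → Kernel (EuclideanSpace ℝ (Fin d)) (EuclideanSpace ℝ (Fin d'))) (t : ℕ) : ℝ≥0∞ :=
  ∫⁻ x, ∫⁻ u, ‖u‖ₑ ^ 2 ∂(U t x) ∂(stateMeasure A B π U t)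

/-- This is the converse of `HasMoments.exists_reach`, with Gaussian states throughout. The one-step
laws are concatenated: changing the law at time `N` does not affect state measures up to time `N`.
-/
lemma Reach.exists_affineGaussian (h : Reach A B m S N m' S' e) (hS : S.PosSemidef) :
    ∃ U : ℕ → Kernel (EuclideanSpace ℝ (Fin d)) (EuclideanSpace ℝ (Fin d')),
      (∀ t < N, IsMarkovKernel (U t)) ∧ (∀ t < N, IsAffineGaussian (U t)) ∧
      (∀ t < N, ∃ (m₁ : EuclideanSpace ℝ (Fin d)) (S₁ : Matrix (Fin d) (Fin d) ℝ),
        S₁.PosSemidef ∧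
        stateMeasure A B (multivariateGaussian m S) U t = multivariateGaussian m₁ S₁) ∧
      stateMeasure A B (multivariateGaussian m S) U N = multivariateGaussian m' S' ∧
      ∑ t ∈ Finset.range N, stepEffort A B (multivariateGaussian m S) U t = ENNReal.ofReal e := by
  induction h with
  | zero => exact ⟨fun _ => 0, by simp, by simp, by simp, rfl, by simp⟩
  | @step N m' S' e h v C V hW ih =>
    obtain ⟨U, h1, h2, h3, h4, h5⟩ := ih
    obtain ⟨U₁, g1, g2, g3, g4⟩ := exists_affineGaussian_step A B m' v hW
    have hU (t : ℕ) (ht : t < N) : Function.update U N U₁ t = U t :=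
      Function.update_of_ne ht.ne _ _
    have hst (t : ℕ) (ht : t ≤ N) : stateMeasure A B (multivariateGaussian m S)
        (Function.update U N U₁) t = stateMeasure A B (multivariateGaussian m S) U t :=
      stateMeasure_congr fun s hs => hU s (by omega)
    refine ⟨Function.update U N U₁, fun t ht => ?_, fun t ht => ?_, fun t ht => ?_, ?_, ?_⟩
    · rcases Nat.lt_succ_iff_lt_or_eq.1 ht with ht | rfl
      · rw [hU t ht]; exact h1 t ht
      · rwa [Function.update_self]
    · rcases Nat.lt_succ_iff_lt_or_eq.1 ht with ht | rfl
      · rw [hU t ht]; exact h2 t ht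
      · rwa [Function.update_self]
    · rw [hst t (by omega)]
      rcases Nat.lt_succ_iff_lt_or_eq.1 ht with ht | rfl
      · exact h3 t ht
      · exact ⟨m', S', h.posSemidef hS, h4⟩
    · rw [stateMeasure, hst N le_rfl, h4, Function.update_self, g3]
    · rw [Finset.sum_range_succ, ENNReal.ofReal_add h.nonneg
        (by have := (posSemidef_toBlocks₂₂ hW).trace_nonneg; positivity), ← h5, ← g4]
      congr 1
      · refine Finset.sum_congr rfl fun t ht => ?_
        rw [Finset.mem_range] at ht
        rw [stepEffort, stepEffort, hst t ht.le, hU t ht]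
      · rw [stepEffort, hst N le_rfl, h4, Function.update_self]

lemma lintegral_enorm_sq_lt_top_iff_memLp {Ω E : Type*} [MeasurableSpace Ω] [NormedAddCommGroup E]
    {P : Measure Ω} {X : Ω → E} (hX : AEStronglyMeasurable X P) :
    ∫⁻ ω, ‖X ω‖ₑ ^ 2 ∂P < ∞ ↔ MemLp X 2 P := by
  rw [MemLp, eLpNorm_lt_top_iff_lintegral_rpow_enorm_lt_top (by simp) (by simp)]
  simp [hX]

/-- One step of a controlled process, at the level of moments. -/
lemma HasMoments.exists_step {μ : Measure (EuclideanSpace ℝ (Fin d))} (hμ : HasMoments μ m S)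
    (U : Kernel (EuclideanSpace ℝ (Fin d)) (EuclideanSpace ℝ (Fin d'))) [IsMarkovKernel U]
    (hU : ∫⁻ x, ∫⁻ u, ‖u‖ₑ ^ 2 ∂U x ∂μ < ∞) :
    ∃ (v : EuclideanSpace ℝ (Fin d')) (C : Matrix (Fin d) (Fin d') ℝ)
      (V : Matrix (Fin d') (Fin d') ℝ), (fromBlocks S C Cᵀ V).PosSemidef ∧
      HasMoments ((μ ⊗ₘ U).map fun q => toEuclideanLin A q.1 + toEuclideanLin B q.2)
        (toEuclideanLin A m + toEuclideanLin B v)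
        (A * S * Aᵀ + A * C * Bᵀ + B * Cᵀ * Aᵀ + B * V * Bᵀ) ∧
      ∫⁻ x, ∫⁻ u, ‖u‖ₑ ^ 2 ∂U x ∂μ = ENNReal.ofReal (‖v‖ ^ 2 + V.trace) := by
  have := hμ.prob
  set P := μ ⊗ₘ U with hP
  have hfst : P.map Prod.fst = μ := Measure.fst_compProd μ U
  have hlin : ∫⁻ x, ∫⁻ u, ‖u‖ₑ ^ 2 ∂U x ∂μ = ∫⁻ q, ‖q.2‖ₑ ^ 2 ∂P := by
    rw [hP, Measure.lintegral_compProd (by fun_prop)]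
  have hX2 : MemLp Prod.fst 2 P := by
    have h := hμ.memLp
    rw [← hfst] at h
    exact (memLp_map_measure_iff (g := id) (by fun_prop) measurable_fst.aemeasurable).1 h
  have hY2 : MemLp Prod.snd 2 P := by
    rw [hlin] at hU
    exact (lintegral_enorm_sq_lt_top_iff_memLp (by fun_prop)).1 hU
  rw [← hfst] at hμ
  set v : EuclideanSpace ℝ (Fin d') := WithLp.toLp 2 fun i => ∫ q, q.2 i ∂P with hv
  set C : Matrix (Fin d) (Fin d') ℝ :=
    Matrix.of fun i j => cov[fun q => q.1 i, fun q => q.2 j; P] with hC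
  set V : Matrix (Fin d') (Fin d') ℝ :=
    Matrix.of fun i j => cov[fun q => q.2 i, fun q => q.2 j; P] with hV
  have hS := hμ.cov_of_map measurable_fst
  refine ⟨v, C, V, ?_, ?_, ?_⟩
  · have := posSemidef_cov (P := P)
      (Z := Sum.elim (fun (i : Fin d) q => q.1 i) (fun (i : Fin d') q => q.2 i))
      (by rintro (i | i)
          exacts [memLp_coord hX2 i, memLp_coord hY2 i])
    convert this using 1
    ext (i | i) (j | j)
    · exact (hS i j).symm
    · rfl
    · exact covariance_comm _ _
    · rfl
  · exact hasMoments_map_add measurable_fst measurable_snd hX2 hY2 A B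
      (hμ.mean_of_map measurable_fst) (fun i => rfl) hS (fun i j => rfl) (fun i j => rfl)
  · have h := (hasMoments_map (m := v) (S := V) measurable_snd hY2 (fun i => rfl)
      (fun i j => rfl)).lintegral_enorm_sq
    rw [hlin, ← h, lintegral_map (by fun_prop) measurable_snd]

/-- The moments of a controlled process with finite effort are reachable. -/
lemma HasMoments.exists_reach {μ : Measure (EuclideanSpace ℝ (Fin d))} (hμ : HasMoments μ m S)
    {U : ℕ → Kernel (EuclideanSpace ℝ (Fin d)) (EuclideanSpace ℝ (Fin d'))} {N : ℕ}
    (hU : ∀ t < N, IsMarkovKernel (U t))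
    (hE : ∑ t ∈ Finset.range N, stepEffort A B μ U t < ∞) :
    ∃ m' S' e, Reach A B m S N m' S' e ∧ HasMoments (stateMeasure A B μ U N) m' S' ∧
      ∑ t ∈ Finset.range N, stepEffort A B μ U t = ENNReal.ofReal e := by
  induction N with
  | zero => exact ⟨m, S, 0, .zero, hμ, by simp⟩
  | succ N ih =>
    rw [Finset.sum_range_succ, ENNReal.add_lt_top] at hE
    obtain ⟨m', S', e, h1, h2, h3⟩ := ih (fun t ht => hU t (by omega)) hE.1
    have := hU N (by omega)
    obtain ⟨v, C, V, g1, g2, g3⟩ := h2.exists_step (A := A) (B := B) (U N) hE.2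
    refine ⟨_, _, _, h1.step v C V g1, g2, ?_⟩
    rw [Finset.sum_range_succ, h3, stepEffort, g3, ENNReal.ofReal_add h1.nonneg
        (by have := (posSemidef_toBlocks₂₂ g1).trace_nonneg; positivity)]

lemma isFiniteMeasure_stateMeasure {μ : Measure (EuclideanSpace ℝ (Fin d))} [IsFiniteMeasure μ]
    {U : ℕ → Kernel (EuclideanSpace ℝ (Fin d)) (EuclideanSpace ℝ (Fin d'))} {N : ℕ}
    (hU : ∀ t < N, IsMarkovKernel (U t)) : IsFiniteMeasure (stateMeasure A B μ U N) := by
  induction N with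
  | zero => assumption
  | succ N ih =>
    have := ih fun t ht => hU t (by omega)
    have := hU N (by omega)
    rw [stateMeasure]
    infer_instance

/-- Kernels and pushforwards act linearly on measures, which is what allows the total mass to be
separated from the normalized plan. -/
lemma stateMeasure_smul (c : ℝ≥0∞) {μ : Measure (EuclideanSpace ℝ (Fin d))} [IsFiniteMeasure μ]
    {U : ℕ → Kernel (EuclideanSpace ℝ (Fin d)) (EuclideanSpace ℝ (Fin d'))} {N : ℕ}
    (hU : ∀ t < N, IsMarkovKernel (U t)) :
    stateMeasure A B (c • μ) U N = c • stateMeasure A B μ U N := by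
  induction N with
  | zero => rfl
  | succ N ih =>
    have := isFiniteMeasure_stateMeasure (A := A) (B := B) (μ := μ) (U := U) (N := N)
      fun t ht => hU t (by omega)
    have := hU N (by omega)
    rw [stateMeasure, stateMeasure, ih fun t ht => hU t (by omega), Measure.compProd_smul_left,
      Measure.map_smul]

lemma stepEffort_smul (c : ℝ≥0∞) {μ : Measure (EuclideanSpace ℝ (Fin d))} [IsFiniteMeasure μ]
    {U : ℕ → Kernel (EuclideanSpace ℝ (Fin d)) (EuclideanSpace ℝ (Fin d'))} {N : ℕ}
    (hU : ∀ t < N, IsMarkovKernel (U t)) :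
    stepEffort A B (c • μ) U N = c * stepEffort A B μ U N := by
  rw [stepEffort, stateMeasure_smul c hU, lintegral_smul_measure, smul_eq_mul, stepEffort]

end UDC

/-! ### Compactness of semidefinite matrices and coercivity of the Gaussian divergence -/

namespace UDC

section PosSemidef

variable {ι : Type*} [Fintype ι]

lemma isClosed_posSemidef : IsClosed {W : Matrix ι ι ℝ | W.PosSemidef} := by
  simp_rw [posSemidef_iff_dotProduct_mulVec, Set.ofPred_and, Set.ofPred_forall]
  refine IsClosed.inter ?_ (isClosed_iInter fun x => ?_)
  · exact isClosed_eq continuous_id.matrix_conjTranspose continuous_id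
  · exact isClosed_le continuous_const
      (Continuous.dotProduct continuous_const (continuous_id.matrix_mulVec continuous_const))

/-- Testing the form on `e_i + e_j` and `e_i - e_j` bounds an off-diagonal entry by the mean of two
diagonal ones. -/
lemma abs_apply_le_trace [DecidableEq ι] {W : Matrix ι ι ℝ} (hW : W.PosSemidef) (i j : ι) :
    |W i j| ≤ W.trace := by
  have hdiag (i : ι) : 0 ≤ W i i := hW.diag_nonneg
  have hsymm : W j i = W i j := by
    have := hW.1.apply i j
    simpa using this
  rcases eq_or_ne i j with rfl | hij
  · rw [abs_of_nonneg (hdiag i)]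
    exact Finset.single_le_sum (f := fun k => W k k) (fun k _ => hdiag k) (Finset.mem_univ i)
  have htr : W i i + W j j ≤ W.trace := by
    rw [← Finset.sum_pair (f := fun k => W k k) hij]
    exact Finset.sum_le_sum_of_subset_of_nonneg (Finset.subset_univ _) fun k _ _ => hdiag k
  have h1 := hW.dotProduct_mulVec_nonneg (Pi.single i 1 + Pi.single j 1)
  have h2 := hW.dotProduct_mulVec_nonneg (Pi.single i 1 - Pi.single j 1)
  simp only [star_trivial, mulVec_add, mulVec_sub, add_dotProduct, sub_dotProduct,
    dotProduct_add, dotProduct_sub, mulVec_single_one, single_one_dotProduct, col_apply, hsymm]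
    at h1 h2
  have := hdiag i
  have := hdiag j
  rw [abs_le]
  constructor <;> linarith

lemma isCompact_posSemidef_trace_le [DecidableEq ι] (R : ℝ) :
    IsCompact {W : Matrix ι ι ℝ | W.PosSemidef ∧ W.trace ≤ R} := by
  have hbox : IsCompact (Set.pi Set.univ fun _ : ι => Set.pi Set.univ fun _ : ι => Set.Icc (-R) R) :=
    isCompact_univ_pi fun _ => isCompact_univ_pi fun _ => isCompact_Icc
  refine hbox.of_isClosed_subset (IsClosed.inter isClosed_posSemidef
    (isClosed_le continuous_id.matrix_trace continuous_const)) fun W hW i _ j _ => ?_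
  exact abs_le.1 ((abs_apply_le_trace hW.1 i j).trans hW.2)

lemma exists_pos_mul_le_of_posDef {P : Matrix ι ι ℝ} (hP : P.PosDef) :
    ∃ a > 0, ∀ y : ι → ℝ, a * (y ⬝ᵥ y) ≤ y ⬝ᵥ P *ᵥ y := by
  have hcont : Continuous fun y : ι → ℝ => y ⬝ᵥ P *ᵥ y :=
    Continuous.dotProduct continuous_id (continuous_const.matrix_mulVec continuous_id)
  have hcont' : Continuous fun y : EuclideanSpace ℝ ι => y.ofLp ⬝ᵥ P *ᵥ y.ofLp :=
    hcont.comp (by fun_prop)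
  have hn (y : EuclideanSpace ℝ ι) : y.ofLp ⬝ᵥ y.ofLp = ‖y‖ ^ 2 := by
    rw [EuclideanSpace.real_norm_sq_eq]; simp [dotProduct, sq]
  rcases (Metric.sphere (0 : EuclideanSpace ℝ ι) 1).eq_empty_or_nonempty with he | hne
  · refine ⟨1, one_pos, fun y => ?_⟩
    have hy : y = 0 := by
      by_contra hy
      have hy' : WithLp.toLp 2 y ≠ (0 : EuclideanSpace ℝ ι) := fun h => hy (congrArg WithLp.ofLp h)
      have : (‖WithLp.toLp 2 y‖⁻¹ • WithLp.toLp 2 y) ∈ Metric.sphere (0 : EuclideanSpace ℝ ι) 1 := by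
        rw [mem_sphere_zero_iff_norm, norm_smul, norm_inv, norm_norm,
          inv_mul_cancel₀ (norm_ne_zero_iff.2 hy')]
      rw [he] at this
      exact this
    simp [hy]
  · obtain ⟨u, hu, hmin⟩ := (isCompact_sphere (0 : EuclideanSpace ℝ ι) 1).exists_isMinOn hne
      hcont'.continuousOn
    have hu0 : u.ofLp ≠ 0 := fun h => by
      have h0 : u = 0 := by ext i; exact congrFun h i
      simp [h0] at hu
    refine ⟨u.ofLp ⬝ᵥ P *ᵥ u.ofLp, by simpa using hP.dotProduct_mulVec_pos hu0, fun y => ?_⟩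
    rcases eq_or_ne y 0 with rfl | hy
    · simp
    set z : EuclideanSpace ℝ ι := WithLp.toLp 2 y with hz
    have hz0 : ‖z‖ ≠ 0 := norm_ne_zero_iff.2 fun h => hy (congrArg WithLp.ofLp h)
    have hmem : (‖z‖⁻¹ • z) ∈ Metric.sphere (0 : EuclideanSpace ℝ ι) 1 := by
      rw [mem_sphere_zero_iff_norm, norm_smul, norm_inv, norm_norm, inv_mul_cancel₀ hz0]
    have h := isMinOn_iff.1 hmin _ hmem
    rw [WithLp.ofLp_smul, mulVec_smul, smul_dotProduct, dotProduct_smul, smul_eq_mul,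
      smul_eq_mul, ← mul_assoc] at h
    have h2 := mul_le_mul_of_nonneg_right h (sq_nonneg ‖z‖)
    have e : y ⬝ᵥ y = ‖z‖ ^ 2 := hn z
    rw [e]
    refine h2.trans_eq ?_
    change ‖z‖⁻¹ * ‖z‖⁻¹ * (y ⬝ᵥ P *ᵥ y) * ‖z‖ ^ 2 = y ⬝ᵥ P *ᵥ y
    field_simp

end PosSemidef

variable {n : ℕ}

/-- This is the source of coercivity. The divergence from the widened Gaussian is still nonnegative,
so the divergence from the original one dominates a quarter of the quadratic term, up to a constant.
-/
lemma gaussianKL_two_smul (m m₁ : EuclideanSpace ℝ (Fin n)) (S : Matrix (Fin n) (Fin n) ℝ)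
    {S₁ : Matrix (Fin n) (Fin n) ℝ} (hS₁ : S₁.PosDef) :
    gaussianKL m S m₁ S₁ = gaussianKL m S m₁ ((2 : ℝ) • S₁) +
      1 / 4 * ((S₁⁻¹ * S).trace + (m - m₁).ofLp ⬝ᵥ S₁⁻¹ *ᵥ (m - m₁).ofLp)
        - n / 2 * Real.log 2 := by
  have hinv : ((2 : ℝ) • S₁)⁻¹ = (1 / 2 : ℝ) • S₁⁻¹ := by
    refine inv_eq_right_inv ?_
    rw [smul_mul_smul_comm, mul_nonsing_inv _ (isUnit_iff_ne_zero.2 hS₁.det_pos.ne')]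
    norm_num
  rw [gaussianKL, gaussianKL, hinv, det_smul, Fintype.card_fin,
    Real.log_mul (by positivity) hS₁.det_pos.ne', Real.log_pow, smul_mul, trace_smul, smul_mulVec,
    dotProduct_smul, smul_eq_mul, smul_eq_mul]
  ring

/-- Sublevel sets of the Gaussian Kullback-Leibler divergence are bounded and nondegenerate. -/
lemma exists_bounds_of_gaussianKL_le (m₁ : EuclideanSpace ℝ (Fin n))
    {S₁ : Matrix (Fin n) (Fin n) ℝ} (hS₁ : S₁.PosDef) (T : ℝ) :
    ∃ R δ, 0 < δ ∧ ∀ (m : EuclideanSpace ℝ (Fin n)) (S : Matrix (Fin n) (Fin n) ℝ), S.PosDef →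
      gaussianKL m S m₁ S₁ ≤ T → ‖m‖ ≤ R ∧ S.trace ≤ R ∧ δ ≤ S.det := by
  obtain ⟨a, ha, hP⟩ := exists_pos_mul_le_of_posDef hS₁.inv
  -- The quotient bounds `S.trace + ‖m - m₁‖ ^ 2`, and the 1 comes from `r ≤ 1 + r ^ 2`. The
  -- determinant bound solves `gaussianKL ≤ T` for `log (det S)` after dropping the nonnegative
  -- quadratic term.
  refine ⟨‖m₁‖ + 1 + 4 * (T + n / 2 * Real.log 2) / a, Real.exp (Real.log S₁.det - n - 2 * T),
    Real.exp_pos _, fun m S hS hT => ?_⟩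
  set X := (S₁⁻¹ * S).trace + (m - m₁).ofLp ⬝ᵥ S₁⁻¹ *ᵥ (m - m₁).ofLp with hX
  have hnorm : (m - m₁).ofLp ⬝ᵥ (1 : Matrix (Fin n) (Fin n) ℝ) *ᵥ (m - m₁).ofLp = ‖m - m₁‖ ^ 2 := by
    rw [EuclideanSpace.real_norm_sq_eq, one_mulVec]; simp [dotProduct, sq]
  -- Both sides are integrals of quadratic forms in `x - m₁` under N(m, S), so the pointwise bound
  -- `hP` can be integrated.
  have hlow : a * (S.trace + ‖m - m₁‖ ^ 2) ≤ X := by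
    have hg := hasMoments_multivariateGaussian m hS.posSemidef
    have h1 := hg.integral_quadratic S₁⁻¹ m₁
    have h2 := hg.integral_quadratic 1 m₁
    rw [Matrix.one_mul, hnorm] at h2
    rw [hX, ← h1, ← h2, ← integral_const_mul]
    refine integral_mono ((hg.integrable_quadratic 1 m₁).const_mul a)
      (hg.integrable_quadratic S₁⁻¹ m₁) fun x => ?_
    simp only [one_mulVec]
    exact hP _
  have hX4 : X ≤ 4 * (T + n / 2 * Real.log 2) := by
    have h1 := gaussianKL_two_smul m m₁ S hS₁
    have h2 := gaussianKL_nonneg m m₁ hS (hS₁.smul (two_pos : (0 : ℝ) < 2))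
    linarith
  have htr := hS.posSemidef.trace_nonneg
  have hX0 : 0 ≤ X := le_trans (by positivity) hlow
  have hbd : S.trace + ‖m - m₁‖ ^ 2 ≤ 4 * (T + n / 2 * Real.log 2) / a := by
    rw [le_div_iff₀ ha]; linarith
  have hm : ‖m‖ ≤ ‖m₁‖ + ‖m - m₁‖ := by
    simpa using norm_add_le m₁ (m - m₁)
  refine ⟨?_, ?_, ?_⟩
  · nlinarith [sq_nonneg (‖m - m₁‖ - 1), norm_nonneg (m - m₁)]
  · have := norm_nonneg m₁
    nlinarith [sq_nonneg ‖m - m₁‖]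
  · rw [← Real.le_log_iff_exp_le hS.det_pos]
    rw [gaussianKL, ← hX] at hT
    linarith

lemma continuousOn_gaussianKL (m₁ : EuclideanSpace ℝ (Fin n)) (S₁ : Matrix (Fin n) (Fin n) ℝ)
    {Y : Type*} [TopologicalSpace Y] {s : Set Y} {f : Y → EuclideanSpace ℝ (Fin n)}
    {g : Y → Matrix (Fin n) (Fin n) ℝ} (hf : Continuous f) (hg : Continuous g)
    (hs : ∀ y ∈ s, (g y).det ≠ 0) : ContinuousOn (fun y => gaussianKL (f y) (g y) m₁ S₁) s := by
  have h1 : Continuous fun y => (f y - m₁).ofLp := by fun_prop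
  have h2 : Continuous fun y => (f y - m₁).ofLp ⬝ᵥ S₁⁻¹ *ᵥ (f y - m₁).ofLp :=
    Continuous.dotProduct h1 (continuous_const.matrix_mulVec h1)
  have h3 : Continuous fun y => (S₁⁻¹ * g y).trace := (continuous_const.matrix_mul hg).matrix_trace
  unfold gaussianKL
  exact continuousOn_const.mul (((((h3.add h2).sub continuous_const).add
    continuous_const).continuousOn).sub (hg.matrix_det.continuousOn.log hs))

end UDC

/-! ### Existence of optimal normalized moments -/

namespace UDC

variable {d d' : ℕ}

/-- Tuples of initial mean and covariance, terminal mean and covariance, and control effort. -/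
abbrev MomentData (d : ℕ) : Type :=
  (EuclideanSpace ℝ (Fin d) × Matrix (Fin d) (Fin d) ℝ) ×
    (EuclideanSpace ℝ (Fin d) × Matrix (Fin d) (Fin d) ℝ) × ℝ

/-- The reachable moment data with bounded initial moments and effort. -/
def reachSet (A : Matrix (Fin d) (Fin d) ℝ) (B : Matrix (Fin d) (Fin d') ℝ) (R : ℝ) (N : ℕ) :
    Set (MomentData d) :=
  {x | x.1.2.PosSemidef ∧ ‖x.1.1‖ ≤ R ∧ x.1.2.trace ≤ R ∧ x.2.2 ≤ R ∧
    Reach A B x.1.1 x.1.2 N x.2.1.1 x.2.1.2 x.2.2}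

@[fun_prop]
lemma continuous_toEuclideanLin {k l : ℕ} (M : Matrix (Fin k) (Fin l) ℝ) :
    Continuous (toEuclideanLin M) :=
  LinearMap.continuous_of_finiteDimensional _

/-- By induction, the set after one more step is a continuous image of a compact set: earlier data
are compact, and the effort bound confines the mean and covariance of the new control.
Cross-covariances need no separate bound, since the trace controls every entry of a semidefinite
block matrix. -/
lemma isCompact_reachSet (A : Matrix (Fin d) (Fin d) ℝ) (B : Matrix (Fin d) (Fin d') ℝ) {R : ℝ}
    (hR : 0 ≤ R) (N : ℕ) : IsCompact (reachSet A B R N) := by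
  induction N with
  | zero =>
    have hK := (isCompact_closedBall (0 : EuclideanSpace ℝ (Fin d)) R).prod
      (isCompact_posSemidef_trace_le (ι := Fin d) R)
    have hcont : Continuous fun y : EuclideanSpace ℝ (Fin d) × Matrix (Fin d) (Fin d) ℝ =>
        ((y, y, 0) : MomentData d) := by fun_prop
    convert hK.image hcont
    ext ⟨⟨m, S⟩, ⟨m', S'⟩, e⟩
    simp only [reachSet, Set.mem_ofPred_eq, Set.mem_image, Set.mem_prod, Metric.mem_closedBall,
      dist_zero_right, Prod.exists, Prod.mk.injEq]
    constructor
    · rintro ⟨h1, h2, h3, h4, h5⟩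
      cases h5
      exact ⟨m, S, ⟨h2, h1, h3⟩, ⟨rfl, rfl⟩, ⟨rfl, rfl⟩, rfl⟩
    · rintro ⟨m₀, S₀, ⟨h2, h1, h3⟩, ⟨rfl, rfl⟩, ⟨rfl, rfl⟩, rfl⟩
      exact ⟨h1, h2, h3, hR, .zero⟩
  | succ N ih =>
    obtain ⟨R₂, hR₂⟩ : ∃ R₂, ∀ x ∈ reachSet A B R N, x.2.1.2.trace ≤ R₂ := by
      have hcont : Continuous fun x : MomentData d => x.2.1.2.trace :=
        Continuous.matrix_trace (by fun_prop)
      obtain ⟨R₂, h⟩ := (ih.image hcont).bddAbove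
      exact ⟨R₂, fun x hx => h ⟨x, hx, rfl⟩⟩
    let Y := MomentData d × EuclideanSpace ℝ (Fin d') × Matrix (Fin d ⊕ Fin d') (Fin d ⊕ Fin d') ℝ
    have hW : Continuous fun y : Y => y.2.2 := by fun_prop
    have h11 : Continuous fun y : Y => y.2.2.toBlocks₁₁ := hW.matrix_submatrix _ _
    have h12 : Continuous fun y : Y => y.2.2.toBlocks₁₂ := hW.matrix_submatrix _ _
    have h22 : Continuous fun y : Y => y.2.2.toBlocks₂₂ := hW.matrix_submatrix _ _
    have hS' : Continuous fun y : Y => y.1.2.1.2 := by fun_prop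
    have heff : Continuous fun y : Y => y.1.2.2 + (‖y.2.1‖ ^ 2 + y.2.2.toBlocks₂₂.trace) :=
      Continuous.add (by fun_prop) (Continuous.add (by fun_prop) h22.matrix_trace)
    -- The radius `R + 1` is enough because `‖v‖ ^ 2 ≤ R` gives `‖v‖ ≤ R + 1`. The closed conditions
    -- make the first block equal to the current state covariance and keep the total effort at most
    -- `R`.
    have hK : IsCompact ((reachSet A B R N ×ˢ Metric.closedBall (0 : EuclideanSpace ℝ (Fin d')) (R + 1)
        ×ˢ {W : Matrix (Fin d ⊕ Fin d') (Fin d ⊕ Fin d') ℝ | W.PosSemidef ∧ W.trace ≤ R₂ + R}) ∩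
        {y : Y | y.2.2.toBlocks₁₁ = y.1.2.1.2 ∧
          y.1.2.2 + (‖y.2.1‖ ^ 2 + y.2.2.toBlocks₂₂.trace) ≤ R}) :=
      (ih.prod ((isCompact_closedBall _ _).prod (isCompact_posSemidef_trace_le _))).inter_right
        ((isClosed_eq h11 hS').inter (isClosed_le heff continuous_const))
    have hcont : Continuous fun y : Y => ((y.1.1,
        (toEuclideanLin A y.1.2.1.1 + toEuclideanLin B y.2.1,
          A * y.1.2.1.2 * Aᵀ + A * y.2.2.toBlocks₁₂ * Bᵀ + B * y.2.2.toBlocks₁₂ᵀ * Aᵀ +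
            B * y.2.2.toBlocks₂₂ * Bᵀ),
        y.1.2.2 + (‖y.2.1‖ ^ 2 + y.2.2.toBlocks₂₂.trace)) : MomentData d) := by
      have c := continuous_const (X := Y) (y := A)
      have c' := continuous_const (X := Y) (y := B)
      have k := continuous_const (X := Y) (y := Aᵀ)
      have k' := continuous_const (X := Y) (y := Bᵀ)
      refine Continuous.prodMk (by fun_prop) (Continuous.prodMk (Continuous.prodMk (by fun_prop) ?_)
        heff)
      exact ((((c.matrix_mul hS').matrix_mul k).add ((c.matrix_mul h12).matrix_mul k')).add
        ((c'.matrix_mul h12.matrix_transpose).matrix_mul k)).add ((c'.matrix_mul h22).matrix_mul k')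
    convert hK.image hcont
    ext ⟨⟨m, S⟩, ⟨m', S'⟩, e⟩
    simp only [reachSet, Set.mem_ofPred_eq, Set.mem_image]
    constructor
    · rintro ⟨h1, h2, h3, h4, h5⟩
      cases h5 with
      | @step _ m₀ S₀ e₀ h v C V hW =>
        have htr := (posSemidef_toBlocks₂₂ hW).trace_nonneg
        have he0 := h.nonneg
        have hx : ((m, S), (m₀, S₀), e₀) ∈ reachSet A B R N :=
          ⟨h1, h2, h3, by nlinarith [sq_nonneg ‖v‖], h⟩
        refine ⟨(((m, S), (m₀, S₀), e₀), v, fromBlocks S₀ C Cᵀ V),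
          ⟨⟨hx, ?_, hW, ?_⟩, ?_, ?_⟩, ?_⟩
        · rw [Metric.mem_closedBall, dist_zero_right]
          nlinarith [sq_nonneg (‖v‖ - 1), norm_nonneg v]
        · have htb : (fromBlocks S₀ C Cᵀ V).trace = S₀.trace + V.trace := by
            simp [trace, Fintype.sum_sum_type]
          have := hR₂ _ hx
          simp only at this
          rw [htb]
          nlinarith [sq_nonneg ‖v‖]
        · simp
        · simpa using h4
        · simp
    · rintro ⟨⟨⟨⟨m₁, S₁⟩, ⟨m₂, S₂⟩, e₂⟩, v, W⟩, ⟨⟨⟨h1, h2, h3, h4, h5⟩, h6, h7, h8⟩, h9, h10⟩, heq⟩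
      simp only [Prod.mk.injEq] at heq h9
      obtain ⟨⟨rfl, rfl⟩, ⟨rfl, rfl⟩, rfl⟩ := heq
      refine ⟨h1, h2, h3, h10, h5.step v _ _ ?_⟩
      have hT : W.toBlocks₁₂ᵀ = W.toBlocks₂₁ := by
        ext i j
        simpa using! h7.1.apply (Sum.inr i) (Sum.inl j)
      simp only at h9 ⊢
      rw [hT, ← h9, fromBlocks_toBlocks]
      exact h7

/-- Zero control maps the covariance to `A * S * Aᵀ`, nondegenerate since `A` is invertible. This
supplies a competitor with nonsingular terminal covariance; invertibility of `A` enters the proof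
only here. -/
lemma exists_reach_posDef {A : Matrix (Fin d) (Fin d) ℝ} (hA : IsUnit A.det)
    (B : Matrix (Fin d) (Fin d') ℝ) (m : EuclideanSpace ℝ (Fin d)) {S : Matrix (Fin d) (Fin d) ℝ}
    (hS : S.PosDef) (N : ℕ) : ∃ m' S' e, Reach A B m S N m' S' e ∧ S'.PosDef := by
  induction N with
  | zero => exact ⟨m, S, 0, .zero, hS⟩
  | succ N ih =>
    obtain ⟨m', S', e, h, hS'⟩ := ih
    have hW : (fromBlocks S' (0 : Matrix (Fin d) (Fin d') ℝ) 0ᵀ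
        (0 : Matrix (Fin d') (Fin d') ℝ)).PosSemidef := by
      have := hS'.posSemidef.mul_mul_conjTranspose_same
        (fromRows (1 : Matrix (Fin d) (Fin d) ℝ) (0 : Matrix (Fin d') (Fin d) ℝ))
      rw [conjTranspose_eq_transpose_of_trivial, transpose_fromRows, fromRows_mul,
        fromRows_mul_fromCols] at this
      simpa using this
    refine ⟨_, _, _, h.step 0 0 0 hW, ?_⟩
    have := hS'.mul_mul_conjTranspose_same (B := A) (vecMul_injective_iff_isUnit.2
      ((isUnit_iff_isUnit_det A).2 hA))
    simpa using this

/-- The balanced cost of moment data. -/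
noncomputable def momentCost (γ : ℝ) (mα mβ : EuclideanSpace ℝ (Fin d))
    (Sα Sβ : Matrix (Fin d) (Fin d) ℝ) (x : MomentData d) : ℝ :=
  x.2.2 + γ * gaussianKL x.1.1 x.1.2 mα Sα + γ * gaussianKL x.2.1.1 x.2.1.2 mβ Sβ

/-- All three terms of the cost are nonnegative, so anything no worse than the uncontrolled
competitor `x₀` has each divergence at most `J x₀ / γ` and effort at most `J x₀`. This confines it
to a compact set with determinants bounded below, where the cost is continuous. -/
lemma exists_momentCost_min {A : Matrix (Fin d) (Fin d) ℝ} (hA : IsUnit A.det)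
    (B : Matrix (Fin d) (Fin d') ℝ) {γ : ℝ} (hγ : 0 < γ) (mα mβ : EuclideanSpace ℝ (Fin d))
    {Sα Sβ : Matrix (Fin d) (Fin d) ℝ} (hSα : Sα.PosDef) (hSβ : Sβ.PosDef) (N : ℕ) :
    ∃ x : MomentData d, x.1.2.PosDef ∧ x.2.1.2.PosDef ∧
      Reach A B x.1.1 x.1.2 N x.2.1.1 x.2.1.2 x.2.2 ∧
      ∀ y : MomentData d, y.1.2.PosDef → y.2.1.2.PosDef →
        Reach A B y.1.1 y.1.2 N y.2.1.1 y.2.1.2 y.2.2 →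
        momentCost γ mα mβ Sα Sβ x ≤ momentCost γ mα mβ Sα Sβ y := by
  obtain ⟨m', S', e, hr, hS'⟩ := exists_reach_posDef hA B mα hSα N
  set x₀ : MomentData d := ((mα, Sα), (m', S'), e) with hx₀
  set J := momentCost γ mα mβ Sα Sβ with hJ
  obtain ⟨Rα, δα, hδα, hα⟩ := exists_bounds_of_gaussianKL_le mα hSα (J x₀ / γ)
  obtain ⟨Rβ, δβ, hδβ, hβ⟩ := exists_bounds_of_gaussianKL_le mβ hSβ (J x₀ / γ)
  set R := max 0 (max Rα (J x₀)) with hR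
  set K : Set (MomentData d) := reachSet A B R N ∩ ({x | δα ≤ x.1.2.det} ∩ {x | δβ ≤ x.2.1.2.det})
    with hK
  have hKc : IsCompact K := (isCompact_reachSet A B (le_max_left _ _) N).inter_right
    ((isClosed_le continuous_const (Continuous.matrix_det (by fun_prop))).inter
      (isClosed_le continuous_const (Continuous.matrix_det (by fun_prop))))
  have hmem (y : MomentData d) (h1 : y.1.2.PosDef) (h2 : y.2.1.2.PosDef)
      (h3 : Reach A B y.1.1 y.1.2 N y.2.1.1 y.2.1.2 y.2.2) (hy : J y ≤ J x₀) : y ∈ K := by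
    have e0 := h3.nonneg
    have k1 := mul_nonneg hγ.le (gaussianKL_nonneg y.1.1 mα h1 hSα)
    have k2 := mul_nonneg hγ.le (gaussianKL_nonneg y.2.1.1 mβ h2 hSβ)
    have hJy : J y = y.2.2 + γ * gaussianKL y.1.1 y.1.2 mα Sα +
      γ * gaussianKL y.2.1.1 y.2.1.2 mβ Sβ := rfl
    obtain ⟨b1, b2, b3⟩ := hα y.1.1 y.1.2 h1 (by rw [le_div_iff₀ hγ]; linarith)
    obtain ⟨-, -, b4⟩ := hβ y.2.1.1 y.2.1.2 h2 (by rw [le_div_iff₀ hγ]; linarith)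
    have r1 : Rα ≤ R := (le_max_left _ _).trans (le_max_right _ _)
    have r2 : J x₀ ≤ R := (le_max_right _ _).trans (le_max_right _ _)
    exact ⟨⟨h1.posSemidef, b1.trans r1, b2.trans r1, by linarith, h3⟩, b3, b4⟩
  have hcont : ContinuousOn J K := by
    refine (Continuous.continuousOn (by fun_prop) |>.add (continuousOn_const.mul
      (continuousOn_gaussianKL mα Sα (by fun_prop) (by fun_prop) fun y hy => ?_))).add
      (continuousOn_const.mul
      (continuousOn_gaussianKL mβ Sβ (by fun_prop) (by fun_prop) fun y hy => ?_))
    · exact (hδα.trans_le hy.2.1).ne'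
    · exact (hδβ.trans_le hy.2.2).ne'
  have hx₀K : x₀ ∈ K := hmem x₀ hSα hS' hr le_rfl
  obtain ⟨x, hx, hmin⟩ := hKc.exists_isMinOn ⟨x₀, hx₀K⟩ hcont
  have hxr := hx.1.2.2.2.2
  refine ⟨x, ?_, ?_, hxr, fun y h1 h2 h3 => ?_⟩
  · exact hx.1.1.posDef_iff_det_ne_zero.2 (hδα.trans_le hx.2.1).ne'
  · exact (hxr.posSemidef hx.1.1).posDef_iff_det_ne_zero.2 (hδβ.trans_le hx.2.2).ne'
  · by_cases hy : J y ≤ J x₀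
    · exact isMinOn_iff.1 hmin y (hmem y h1 h2 h3 hy)
    · exact (isMinOn_iff.1 hmin x₀ hx₀K).trans (not_le.1 hy).le

end UDC

/-! ### Optimal mass, and comparison of plans with moment data -/

namespace UDC

open InformationTheory

/-- The least cost of a plan of total mass `c` whose normalization costs `j`. -/
noncomputable def scaledCost (γ cα cβ c j : ℝ) : ℝ :=
  c * j + γ * (c * Real.log (c / cα) + cα - c) + γ * (c * Real.log (c / cβ) + cβ - c)

/-- The mass minimizing `scaledCost`. -/
noncomputable def optimalMass (γ cα cβ j : ℝ) : ℝ :=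
  Real.exp (1 / 2 * (Real.log cα + Real.log cβ) - j / (2 * γ))

lemma mul_log_div_nonneg {a c : ℝ} (hc : 0 ≤ c) (ha : 0 < a) :
    0 ≤ c * Real.log (c / a) + a - c := by
  have := mul_nonneg ha.le (klFun_nonneg (div_nonneg hc ha.le))
  have e : a * klFun (c / a) = c * Real.log (c / a) + a - c := by
    rw [klFun_apply]; field_simp
  rwa [e] at this

/-- The terms linear in `c` are absorbed into the logarithm: up to a constant, the cost is `2 * γ`
times the scalar divergence of `c` from `optimalMass`, so minimality is nonnegativity of `klFun`. -/
lemma scaledCost_eq {γ cα cβ : ℝ} (hγ : 0 < γ) (hα : 0 < cα) (hβ : 0 < cβ) {c : ℝ} (hc : 0 ≤ c)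
    (j : ℝ) : scaledCost γ cα cβ c j =
      2 * γ * (optimalMass γ cα cβ j * klFun (c / optimalMass γ cα cβ j)
        - optimalMass γ cα cβ j) + γ * (cα + cβ) := by
  have hpos : 0 < optimalMass γ cα cβ j := Real.exp_pos _
  have hlog : Real.log (optimalMass γ cα cβ j) =
      1 / 2 * (Real.log cα + Real.log cβ) - j / (2 * γ) := Real.log_exp _
  have hj : j = γ * (Real.log cα + Real.log cβ - 2 * Real.log (optimalMass γ cα cβ j)) := by
    rw [hlog]; field_simp; ring
  rw [scaledCost, klFun_apply]
  rcases hc.eq_or_lt with rfl | hc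
  · simp; ring
  nth_rw 1 [hj]
  rw [Real.log_div hc.ne' hα.ne', Real.log_div hc.ne' hβ.ne', Real.log_div hc.ne' hpos.ne']
  field_simp
  ring

lemma scaledCost_optimalMass_le {γ cα cβ : ℝ} (hγ : 0 < γ) (hα : 0 < cα) (hβ : 0 < cβ) {c : ℝ}
    (hc : 0 ≤ c) (j : ℝ) :
    scaledCost γ cα cβ (optimalMass γ cα cβ j) j ≤ scaledCost γ cα cβ c j := by
  have hpos : 0 < optimalMass γ cα cβ j := Real.exp_pos _
  rw [scaledCost_eq hγ hα hβ hpos.le, scaledCost_eq hγ hα hβ hc, div_self hpos.ne', klFun_one]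
  have := mul_nonneg hpos.le (klFun_nonneg (div_nonneg hc hpos.le))
  nlinarith

variable {d d' : ℕ} {A : Matrix (Fin d) (Fin d) ℝ} {B : Matrix (Fin d) (Fin d') ℝ}

/-- The law of a normalized finite measure with finite second moment has moments. -/
lemma exists_hasMoments_smul {n : ℕ} {π : Measure (EuclideanSpace ℝ (Fin n))}
    (hπ : FiniteSecondMoment π) (h0 : π ≠ 0) :
    ∃ (c : ℝ) (p : Measure (EuclideanSpace ℝ (Fin n))) (m : EuclideanSpace ℝ (Fin n))
      (S : Matrix (Fin n) (Fin n) ℝ), 0 < c ∧ π = ENNReal.ofReal c • p ∧ HasMoments p m S := by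
  obtain ⟨hfin, h2⟩ := hπ
  have hu0 : π Set.univ ≠ 0 := by simpa using h0
  have hut : π Set.univ ≠ ∞ := measure_ne_top _ _
  have hprob : IsProbabilityMeasure ((π Set.univ)⁻¹ • π) :=
    ⟨by rw [Measure.smul_apply, smul_eq_mul, ENNReal.inv_mul_cancel hu0 hut]⟩
  have hL : MemLp id 2 ((π Set.univ)⁻¹ • π) := by
    refine MemLp.smul_measure ?_ (ENNReal.inv_ne_top.2 hu0)
    exact (lintegral_enorm_sq_lt_top_iff_memLp (by fun_prop)).1 h2
  refine ⟨(π Set.univ).toReal, (π Set.univ)⁻¹ • π, WithLp.toLp 2 fun i => _, Matrix.of fun i j => _,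
    ENNReal.toReal_pos hu0 hut, ?_, hprob, hL, fun i => rfl, fun i j => rfl⟩
  rw [ENNReal.ofReal_toReal hut, smul_smul, ENNReal.mul_inv_cancel hu0 hut, one_smul]

lemma klDiv_gaussianMeasure {n : ℕ} (m m₁ : EuclideanSpace ℝ (Fin n))
    {S S₁ : Matrix (Fin n) (Fin n) ℝ} (hS : S.PosDef) (hS₁ : S₁.PosDef) {c a : ℝ}
    (hc : 0 < c) (ha : 0 < a) :
    klDiv (gaussianMeasure c m S) (gaussianMeasure a m₁ S₁) =
      ENNReal.ofReal (c * gaussianKL m S m₁ S₁ + (c * Real.log (c / a) + a - c)) := by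
  obtain ⟨h1, h2, h3⟩ := multivariateGaussian_llr m m₁ hS hS₁
  rw [gaussianMeasure, gaussianMeasure, klDiv_smul_smul h1 h2 hc ha, h3]

/-- Among measures with given mass, mean and covariance, the Gaussian minimizes the divergence
from a Gaussian. -/
lemma HasMoments.gaussianKL_le_klDiv {n : ℕ} {p : Measure (EuclideanSpace ℝ (Fin n))}
    {m m₁ : EuclideanSpace ℝ (Fin n)} {S S₁ : Matrix (Fin n) (Fin n) ℝ} (h : HasMoments p m S)
    (hS₁ : S₁.PosDef) {c a : ℝ} (hc : 0 < c) (ha : 0 < a)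
    (hne : klDiv (ENNReal.ofReal c • p) (gaussianMeasure a m₁ S₁) ≠ ∞) :
    S.PosDef ∧ ENNReal.ofReal (c * gaussianKL m S m₁ S₁ + (c * Real.log (c / a) + a - c)) ≤
      klDiv (ENNReal.ofReal c • p) (gaussianMeasure a m₁ S₁) := by
  have := h.prob
  rw [gaussianMeasure] at hne ⊢
  obtain ⟨hac, hint⟩ := klDiv_smul_smul_ne_top hc ha hne
  have hS : S.PosDef := by
    -- Finite divergence makes `p` absolutely continuous with respect to a nondegenerate Gaussian,
    -- hence to Lebesgue measure, which excludes singular covariances.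
    refine h.posDef (hac.trans ?_)
    rw [multivariateGaussian_eq_withDensity m₁ hS₁]
    exact withDensity_absolutelyContinuous _ _
  refine ⟨hS, ?_⟩
  rw [klDiv_smul_smul hac hint hc ha]
  have := h.gaussianKL_le_integral_llr hS hS₁ hac hint
  gcongr

lemma controlEffort_eq_sum (T : ℕ) (π : Measure (EuclideanSpace ℝ (Fin d)))
    (U : ℕ → Kernel (EuclideanSpace ℝ (Fin d)) (EuclideanSpace ℝ (Fin d'))) :
    controlEffort A B T π U = ∑ t ∈ Finset.range (T - 1), stepEffort A B π U t := rfl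

lemma controlEffort_smul (T : ℕ) (c : ℝ≥0∞) {μ : Measure (EuclideanSpace ℝ (Fin d))}
    [IsFiniteMeasure μ]
    {U : ℕ → Kernel (EuclideanSpace ℝ (Fin d)) (EuclideanSpace ℝ (Fin d'))}
    (hU : ∀ t < T - 1, IsMarkovKernel (U t)) :
    controlEffort A B T (c • μ) U = c * controlEffort A B T μ U := by
  rw [controlEffort_eq_sum, controlEffort_eq_sum, Finset.mul_sum]
  refine Finset.sum_congr rfl fun t ht => stepEffort_smul c fun s hs => hU s ?_
  have := Finset.mem_range.1 ht
  omega

lemma finiteSecondMoment_gaussianMeasure {n : ℕ} (c : ℝ) (m : EuclideanSpace ℝ (Fin n))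
    {S : Matrix (Fin n) (Fin n) ℝ} (hS : S.PosSemidef) :
    FiniteSecondMoment (gaussianMeasure c m S) := by
  refine ⟨Measure.smul_finite _ ENNReal.ofReal_ne_top, ?_⟩
  rw [gaussianMeasure, lintegral_smul_measure,
    (hasMoments_multivariateGaussian m hS).lintegral_enorm_sq, smul_eq_mul]
  exact ENNReal.mul_lt_top ENNReal.ofReal_lt_top ENNReal.ofReal_lt_top

section

variable {T : ℕ} {cα cβ γ : ℝ} {mα mβ : EuclideanSpace ℝ (Fin d)} {Sα Sβ : Matrix (Fin d) (Fin d) ℝ}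

lemma add_kl_eq (x : MomentData d) (c : ℝ) :
    c * x.2.2 + γ * (c * gaussianKL x.1.1 x.1.2 mα Sα + (c * Real.log (c / cα) + cα - c)) +
      γ * (c * gaussianKL x.2.1.1 x.2.1.2 mβ Sβ + (c * Real.log (c / cβ) + cβ - c)) =
    scaledCost γ cα cβ c (momentCost γ mα mβ Sα Sβ x) := by
  rw [scaledCost, momentCost]; ring

/-- Reachable moment data are realized by a Gaussian plan with the corresponding cost. -/
lemma exists_gaussian_plan (hcα : 0 < cα) (hcβ : 0 < cβ) (hγ : 0 < γ)
    (hSα : Sα.PosDef) (hSβ : Sβ.PosDef) {x : MomentData d} (hx1 : x.1.2.PosDef)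
    (hx2 : x.2.1.2.PosDef) (hx : Reach A B x.1.1 x.1.2 (T - 1) x.2.1.1 x.2.1.2 x.2.2) {c : ℝ}
    (hc : 0 < c) :
    ∃ U : ℕ → Kernel (EuclideanSpace ℝ (Fin d)) (EuclideanSpace ℝ (Fin d')),
      (∀ t < T - 1, IsAffineGaussian (U t)) ∧
      Admissible A B T (gaussianMeasure c x.1.1 x.1.2) U ∧
      cost A B T γ (gaussianMeasure cα mα Sα) (gaussianMeasure cβ mβ Sβ)
          (gaussianMeasure c x.1.1 x.1.2) U =
        ENNReal.ofReal (scaledCost γ cα cβ c (momentCost γ mα mβ Sα Sβ x)) := by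
  obtain ⟨U, h1, h2, h3, h4, h5⟩ := hx.exists_affineGaussian hx1.posSemidef
  have hst {t : ℕ} (ht : t ≤ T - 1) : stateMeasure A B (gaussianMeasure c x.1.1 x.1.2) U t =
      ENNReal.ofReal c • stateMeasure A B (multivariateGaussian x.1.1 x.1.2) U t :=
    stateMeasure_smul _ fun s hs => h1 s (by omega)
  have hend : stateMeasure A B (gaussianMeasure c x.1.1 x.1.2) U (T - 1) =
      gaussianMeasure c x.2.1.1 x.2.1.2 := by rw [hst le_rfl, h4, gaussianMeasure]
  have heff : controlEffort A B T (gaussianMeasure c x.1.1 x.1.2) U =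
      ENNReal.ofReal (c * x.2.2) := by
    rw [gaussianMeasure, controlEffort_smul T _ h1, controlEffort_eq_sum, h5,
      ENNReal.ofReal_mul hc.le]
  refine ⟨U, h2, ⟨h1, fun t ht => ?_, ?_⟩, ?_⟩
  · rcases (Nat.le_sub_one_of_lt ht).lt_or_eq with ht' | rfl
    · obtain ⟨m₁, S₁, hS₁, he⟩ := h3 t ht'
      rw [hst ht'.le, he]
      exact finiteSecondMoment_gaussianMeasure c m₁ hS₁
    · rw [hend]
      exact finiteSecondMoment_gaussianMeasure c _ hx2.posSemidef
  · rw [heff]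
    exact ENNReal.ofReal_lt_top
  · have k1 := mul_nonneg hc.le (gaussianKL_nonneg x.1.1 mα hx1 hSα)
    have k2 := mul_nonneg hc.le (gaussianKL_nonneg x.2.1.1 mβ hx2 hSβ)
    have l1 := mul_log_div_nonneg hc.le hcα
    have l2 := mul_log_div_nonneg hc.le hcβ
    have he := mul_nonneg hc.le hx.nonneg
    rw [cost, hend, heff, klDiv_gaussianMeasure _ _ hx1 hSα hc hcα,
      klDiv_gaussianMeasure _ _ hx2 hSβ hc hcβ, ← ENNReal.ofReal_mul hγ.le,
      ← ENNReal.ofReal_mul hγ.le, ← ENNReal.ofReal_add he (mul_nonneg hγ.le (by linarith)),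
      ← ENNReal.ofReal_add (add_nonneg he (mul_nonneg hγ.le (by linarith)))
        (mul_nonneg hγ.le (by linarith)), add_kl_eq]

/-- The cost of an admissible plan of finite cost is bounded below through its moment data. -/
lemma exists_scaledCost_le (hT : 1 ≤ T) (hcα : 0 < cα) (hcβ : 0 < cβ) (hγ : 0 < γ)
    (hSα : Sα.PosDef) (hSβ : Sβ.PosDef) {π : Measure (EuclideanSpace ℝ (Fin d))}
    {U : ℕ → Kernel (EuclideanSpace ℝ (Fin d)) (EuclideanSpace ℝ (Fin d'))}
    (hadm : Admissible A B T π U) (h0 : π ≠ 0)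
    (hfin : cost A B T γ (gaussianMeasure cα mα Sα) (gaussianMeasure cβ mβ Sβ) π U ≠ ∞) :
    ∃ (x : MomentData d) (c : ℝ), 0 < c ∧ x.1.2.PosDef ∧ x.2.1.2.PosDef ∧
      Reach A B x.1.1 x.1.2 (T - 1) x.2.1.1 x.2.1.2 x.2.2 ∧
      ENNReal.ofReal (scaledCost γ cα cβ c (momentCost γ mα mβ Sα Sβ x)) ≤
        cost A B T γ (gaussianMeasure cα mα Sα) (gaussianMeasure cβ mβ Sβ) π U := by
  obtain ⟨hU, hsm, hE⟩ := hadm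
  obtain ⟨c, p, m, S, hc, rfl, hp⟩ := exists_hasMoments_smul (hsm 0 (by omega)) h0
  have := hp.prob
  have hc' : ENNReal.ofReal c ≠ 0 := by simpa using hc
  have hγ' : ENNReal.ofReal γ ≠ 0 := by simpa using hγ
  rw [controlEffort_smul T _ hU] at hE
  have hE' : controlEffort A B T p U < ∞ := ENNReal.lt_top_of_mul_ne_top_right hE.ne hc'
  obtain ⟨m', S', e, hr, hp', he⟩ := hp.exists_reach hU hE'
  rw [← controlEffort_eq_sum] at he
  rw [cost, stateMeasure_smul _ hU, controlEffort_smul T _ hU, he, ← ENNReal.ofReal_mul hc.le]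
    at hfin ⊢
  have hf := ENNReal.add_ne_top.1 hfin
  obtain ⟨hS, hk1⟩ := hp.gaussianKL_le_klDiv hSα hc hcα
    (ENNReal.lt_top_of_mul_ne_top_right (ENNReal.add_ne_top.1 hf.1).2 hγ').ne
  obtain ⟨hS', hk2⟩ := hp'.gaussianKL_le_klDiv hSβ hc hcβ
    (ENNReal.lt_top_of_mul_ne_top_right hf.2 hγ').ne
  refine ⟨((m, S), (m', S'), e), c, hc, hS, hS', hr, ?_⟩
  rw [← add_kl_eq]
  -- Only a lower bound is needed, so subadditivity of `ENNReal.ofReal` suffices and no signs have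
  -- to be checked.
  refine ENNReal.ofReal_add_le.trans (add_le_add (ENNReal.ofReal_add_le.trans
    (add_le_add le_rfl ?_)) ?_)
  · rw [ENNReal.ofReal_mul hγ.le]; gcongr
  · rw [ENNReal.ofReal_mul hγ.le]; gcongr

lemma stateMeasure_zero
    (U : ℕ → Kernel (EuclideanSpace ℝ (Fin d)) (EuclideanSpace ℝ (Fin d'))) (t : ℕ) :
    stateMeasure A B 0 U t = 0 := by
  induction t with
  | zero => rfl
  | succ t ih => rw [stateMeasure, ih, Measure.compProd_zero_left, Measure.map_zero]

/-- The zero measure has no normalization and hence no moment data. Its divergences are the masses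
of the references, which is the value of `scaledCost` at `c = 0` for every `j`. -/
lemma scaledCost_zero_le_cost (hcα : 0 < cα) (hcβ : 0 < cβ) (hγ : 0 < γ) (j : ℝ)
    (U : ℕ → Kernel (EuclideanSpace ℝ (Fin d)) (EuclideanSpace ℝ (Fin d'))) :
    ENNReal.ofReal (scaledCost γ cα cβ 0 j) ≤
      cost A B T γ (gaussianMeasure cα mα Sα) (gaussianMeasure cβ mβ Sβ) 0 U := by
  have hα : IsFiniteMeasure (gaussianMeasure cα mα Sα) :=
    Measure.smul_finite _ ENNReal.ofReal_ne_top
  have hβ : IsFiniteMeasure (gaussianMeasure cβ mβ Sβ) :=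
    Measure.smul_finite _ ENNReal.ofReal_ne_top
  rw [cost, stateMeasure_zero, klDiv_zero_left, klDiv_zero_left]
  simp only [gaussianMeasure, Measure.smul_apply, measure_univ, smul_eq_mul, mul_one, scaledCost,
    zero_mul, zero_add, sub_zero]
  rw [ENNReal.ofReal_add (by positivity) (by positivity), ENNReal.ofReal_mul hγ.le,
    ENNReal.ofReal_mul hγ.le]
  gcongr
  exact le_add_self

end

end UDC

theorem mainTheorem6 {d d' T : ℕ} (hd : 1 ≤ d) (hd' : 1 ≤ d') (hT : 1 ≤ T)
    (A : Matrix (Fin d) (Fin d) ℝ) (hA : IsUnit A.det) (B : Matrix (Fin d) (Fin d') ℝ)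
    (cα cβ γ : ℝ) (hcα : 0 < cα) (hcβ : 0 < cβ) (hγ : 0 < γ)
    (mα mβ : EuclideanSpace ℝ (Fin d)) (Sα Sβ : Matrix (Fin d) (Fin d) ℝ)
    (hSα : Sα.PosDef) (hSβ : Sβ.PosDef) :
    ∃ (c : ℝ) (m : EuclideanSpace ℝ (Fin d)) (S : Matrix (Fin d) (Fin d) ℝ)
      (U : ℕ → Kernel (EuclideanSpace ℝ (Fin d)) (EuclideanSpace ℝ (Fin d'))),
      0 < c ∧ S.PosDef ∧
      (∀ t < T - 1, UDC.IsAffineGaussian (U t)) ∧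
      UDC.IsOptimal A B T γ (UDC.gaussianMeasure cα mα Sα) (UDC.gaussianMeasure cβ mβ Sβ)
        (UDC.gaussianMeasure c m S) U := by
  obtain ⟨x, hx1, hx2, hx, hmin⟩ :=
    UDC.exists_momentCost_min hA B hγ mα mβ hSα hSβ (T - 1)
  set j := UDC.momentCost γ mα mβ Sα Sβ x with hj
  have hc : 0 < UDC.optimalMass γ cα cβ j := Real.exp_pos _
  obtain ⟨U, hU, hadm, hcost⟩ :=
    UDC.exists_gaussian_plan hcα hcβ hγ (mα := mα) (mβ := mβ) hSα hSβ hx1 hx2 hx hc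
  refine ⟨_, x.1.1, x.1.2, U, hc, hx1, hU, hadm, fun π U' hadm' => ?_⟩
  rw [hcost, ← hj]
  by_cases h0 : π = 0
  · subst h0
    exact (ENNReal.ofReal_le_ofReal
      (UDC.scaledCost_optimalMass_le hγ hcα hcβ le_rfl j)).trans
      (UDC.scaledCost_zero_le_cost hcα hcβ hγ j U')
  · by_cases hfin : UDC.cost A B T γ (UDC.gaussianMeasure cα mα Sα)
        (UDC.gaussianMeasure cβ mβ Sβ) π U' = ∞
    · rw [hfin]; exact le_top
    obtain ⟨y, c, hc', hy1, hy2, hy, hle⟩ :=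
      UDC.exists_scaledCost_le hT hcα hcβ hγ hSα hSβ hadm' h0 hfin
    -- First the mass is optimized at fixed `j`, then `j` is compared with the cost of the moment
    -- data `y`; the latter enters only through `c * j` with `c` positive.
    refine (ENNReal.ofReal_le_ofReal
      ((UDC.scaledCost_optimalMass_le hγ hcα hcβ hc'.le j).trans ?_)).trans hle
    have := mul_le_mul_of_nonneg_left (hmin y hy1 hy2 hy) hc'.le
    unfold UDC.scaledCost
    linarith
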